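/- **Setting.** Let $\{f_\theta:\theta\in\Theta\}$, $\Theta\subseteq\mathbb R^{p}$ measurable, be a model of densities on $\mathbb R^{d}$, let $\pi$ be a prior probability density on $\Theta$, and let $y_1,y_2,\dots$ be i.i.d. with density $g$ on $\mathbb R^{d}$. For $\gamma>0$ put $$\log\mathcal L_\gamma(y;\theta)=\tfrac1\gamma f_\theta(y)^\gamma-\tfrac1{1+\gamma}\int f_\theta(x)^{1+\gamma}dx ,\qquad \mathcal L_\gamma(y_{1:n};\theta)=\prod_{i=1}^n\mathcal L_\gamma(y_i;\theta),$$ $$p_\gamma(y_{1:n})=\int_\Theta\mathcal L_\gamma(y_{1:n};\theta)\pi(\theta)d\theta,\qquad \Pi_\gamma(\theta\mid y_{1:n})=\frac{\mathcal L_\gamma(y_{1:n};\theta)\pi(\theta)}{p_\gamma(y_{1:n})},\qquad p_\gamma(z\mid y_{-i})=\int_\Theta\mathcal L_\gamma(z;\theta)\Pi_\gamma(\theta\mid y_{-i})d\theta ,$$ where $y_{-i}$ is $y_{1:n}$ without $y_i$. With the Hyvärinen score $\mathcal H(y,q)=\sum_{k=1}^d\{2\,\partial_k^2\log q(y)+(\partial_k\log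 q(y))^2\}$, the leave-one-out score is $\mathcal H_n(\gamma)=\sum_{i=1}^n\mathcal H(y_i,p_\gamma(\cdot\mid y_{-i}))$. Let $$\mathcal J_n(\gamma)=\int\Big\|\nabla\sum_{i=1}^n\log g(y_i)-\nabla\log p_\gamma(y_{1:n})\Big\|^2\prod_{i=1}^n g(y_i)\,dy_{1:n},\qquad \mathcal J(\gamma)=\lim_{n\to\infty}\tfrac1n\mathcal J_n(\gamma).$$ **Conditions.** Let $\Gamma\subset(0,\infty)$ be compact. 1. $g$ is $C^1$ with finite Fisher information $\int\|\nabla\log g\|^2g<\infty$. 2. For $\theta\in\Theta$, $f_\theta$ is positive and $C^2$; $f_\theta(y)$, $\partial_kf_\theta(y)$, $\partial_k^2f_\theta(y)$ are continuous on $\Theta\times\mathbb R^d$; $\int f_\theta^{1+\gamma}$ is finite and continuous in $(\gamma,\theta)\in\Gamma\times\Theta$. 3. There is a continuous $h$ with $\int |h|g<\infty$ such that $|\log\mathcal L_\gamma(y;\theta)|$, $(\partial_{k}\log\mathcal L_\gamma(y;\theta))^2$ and $|\partial_{k}^2\log\mathcal L_\gamma(y;\theta)|$ (derivatives in $y$)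 are at most $h(y)$ for all $\gamma\in\Gamma$, $\theta\in\Theta$, $y\in\mathbb R^d$ and $k$. 4. For each $\gamma\in\Gamma$, the function $\theta\mapsto\int\log\mathcal L_\gamma(y;\theta)g(y)dy$ has a unique maximiser $\theta^\star_\gamma$ on $\Theta$, and the prior charges every neighbourhood of $\theta^\star_\gamma$. 5. There are a compact $K\subseteq\Theta$ and a function $u$ with $\int|u|g<\infty$ and $\int u\,g<0$ such that $\log\mathcal L_\gamma(y;\theta)-\log\mathcal L_\gamma(y;\theta^\star_\gamma)\le u(y)$ for all $\gamma\in\Gamma$, $\theta\in\Theta\setminus K$ and $y$ (no condition if $\Theta$ is compact). 6. $\mathcal J$ has a unique minimiser $\gamma^\star$ on $\Gamma$. **Proposition.** Under conditions 1–5, the limit defining $\mathcal J$ exists, is uniform on $\Gamma$, and $\mathcal J(\gamma)=\int\|\nabla\log g(y)-\nabla_y\log\mathcal L_\gamma(y;\theta^\star_\gamma)\|^2g(y)dy$. For all data $y_{1:n}$ and all $\gamma\in\Gamma$, $$\mathcal H_n(\gamma)=\sum_{i=1}^n\sum_{k=1}^d\Big\{2\,\mathbb E_\gamma\big[\partial_{k}^2\log\mathcal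 L_\gamma(y_i;\theta)+(\partial_{k}\log\mathcal L_\gamma(y_i;\theta))^2\big]-\big(\mathbb E_\gamma[\partial_{k}\log\mathcal L_\gamma(y_i;\theta)]\big)^2\Big\},$$ where $\mathbb E_\gamma$ is the expectation over $\theta\sim\Pi_\gamma(\cdot\mid y_{1:n})$. If $\Gamma\neq\emptyset$, then $\mathcal H_n$ has a minimiser on $\Gamma$. If also condition 6 holds, then with probability one every sequence of minimisers $\hat\gamma_n\in\arg\min_{\gamma\in\Gamma}\mathcal H_n(\gamma)$ satisfies $\hat\gamma_n\to\gamma^\star$ as $n\to\infty$. -/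

import Mathlib

open Real Set Filter Topology MeasureTheory ProbabilityTheory

noncomputable section

namespace RobustBayes

/-- Euclidean space of dimension `m`. -/
abbrev E (m : ℕ) : Type := EuclideanSpace ℝ (Fin m)

/-- Partial derivative of `F` in the `k`-th coordinate of a single observation. -/
def pderiv {d : ℕ} (k : Fin d) (F : E d → ℝ) (y : E d) : ℝ :=
  lineDeriv ℝ F y (EuclideanSpace.single k 1)

/-- Partial derivative of a function of `n` observations in the `k`-th coordinate of the
`i`-th observation. -/
def jointPderiv {n d : ℕ} (i : Fin n) (k : Fin d) (F : (Fin n → E d) → ℝ) (y : Fin n → E d) : ℝ :=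
  lineDeriv ℝ F y (Pi.single i (EuclideanSpace.single k 1))

/-- The Hyvärinen score of the (possibly unnormalised) density `q` at the observation `y`. -/
def hyvarinenScore {d : ℕ} (y : E d) (q : E d → ℝ) : ℝ :=
  ∑ k : Fin d, (2 * pderiv k (pderiv k (fun z => log (q z))) y
    + (pderiv k (fun z => log (q z)) y) ^ 2)

/-- The Fisher divergence `∫ ‖∇ log g - ∇ log q‖² g` for one observation. -/
def fisherDivergence {d : ℕ} (g q : E d → ℝ) : ℝ :=
  ∫ y, (∑ k : Fin d,
    (pderiv k (fun z => log (g z)) y - pderiv k (fun z => log (q z)) y) ^ 2) * g y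

/-- The Fisher divergence `∫ ‖∇ log g - ∇ log q‖² g` for functions of `n` observations. -/
def jointFisherDivergence {n d : ℕ} (g q : (Fin n → E d) → ℝ) : ℝ :=
  ∫ y, (∑ i : Fin n, ∑ k : Fin d,
    (jointPderiv i k (fun z => log (g z)) y - jointPderiv i k (fun z => log (q z)) y) ^ 2) * g y

/-- The logarithm `log 𝓛_γ(y; θ)` of the density-power-divergence pseudo-likelihood of one
observation, for the model densities `f θ`. -/
def logLik {p d : ℕ} (f : E p → E d → ℝ) (γ : ℝ) (y : E d) (θ : E p) : ℝ :=
  1 / γ * f θ y ^ γ - 1 / (1 + γ) * ∫ x, f θ x ^ (1 + γ)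

section Posterior

variable {ι : Type} [Fintype ι] {p d : ℕ}

/-- The pseudo-likelihood `𝓛_γ(y; θ)` of the data `y = (y_j)_{j ∈ ι}`. -/
def lik (f : E p → E d → ℝ) (γ : ℝ) (y : ι → E d) (θ : E p) : ℝ :=
  exp (∑ j, logLik f γ (y j) θ)

/-- The `γ`-marginal (evidence) `p_γ(y) = ∫_Θ 𝓛_γ(y; θ) π(θ) dθ`. -/
def marginal (f : E p → E d → ℝ) (Θ : Set (E p)) (prior : E p → ℝ) (γ : ℝ) (y : ι → E d) : ℝ :=
  ∫ θ in Θ, lik f γ y θ * prior θ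

/-- The density `Π_γ(θ ∣ y)` on `Θ` of the general posterior. -/
def posterior (f : E p → E d → ℝ) (Θ : Set (E p)) (prior : E p → ℝ) (γ : ℝ) (y : ι → E d)
    (θ : E p) : ℝ :=
  lik f γ y θ * prior θ / marginal f Θ prior γ y

/-- The expectation of `φ` under the general posterior given `y`. -/
def postExp (f : E p → E d → ℝ) (Θ : Set (E p)) (prior : E p → ℝ) (γ : ℝ) (y : ι → E d)
    (φ : E p → ℝ) : ℝ :=
  ∫ θ in Θ, φ θ * posterior f Θ prior γ y θ

end Posterior

section Score

variable {n p d : ℕ}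

/-- The leave-one-out predictive `z ↦ p_γ(z ∣ y_{-i}) = ∫_Θ 𝓛_γ(z; θ) Π_γ(θ ∣ y_{-i}) dθ`. -/
def looPredictive (f : E p → E d → ℝ) (Θ : Set (E p)) (prior : E p → ℝ) (γ : ℝ)
    (y : Fin n → E d) (i : Fin n) (z : E d) : ℝ :=
  postExp f Θ prior γ (fun j : {j : Fin n // j ≠ i} => y j) (fun θ => exp (logLik f γ z θ))

/-- The leave-one-out Hyvärinen score `∑ᵢ 𝓗(y_i, p_γ(· ∣ y_{-i}))`. -/
def looScore (f : E p → E d → ℝ) (Θ : Set (E p)) (prior : E p → ℝ) (γ : ℝ)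
    (y : Fin n → E d) : ℝ :=
  ∑ i : Fin n, hyvarinenScore (y i) (looPredictive f Θ prior γ y i)

/-- The score `𝓗_n(γ)` written with expectations under the posterior given all the data. -/
def hScore (f : E p → E d → ℝ) (Θ : Set (E p)) (prior : E p → ℝ) (γ : ℝ)
    (y : Fin n → E d) : ℝ :=
  ∑ i : Fin n, ∑ k : Fin d,
    (2 * postExp f Θ prior γ y (fun θ =>
        pderiv k (pderiv k (fun z => logLik f γ z θ)) (y i)
          + (pderiv k (fun z => logLik f γ z θ) (y i)) ^ 2)
      - (postExp f Θ prior γ y (fun θ => pderiv k (fun z => logLik f γ z θ) (y i))) ^ 2)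

end Score

/-- The Fisher divergence `∫ ‖∇ log g(y_{1:n}) - ∇ log p_γ(y_{1:n})‖² g(y_{1:n}) dy_{1:n}` between
the density of `n` i.i.d. observations and the `γ`-marginal. -/
def marginalFisher {p d : ℕ} (f : E p → E d → ℝ) (Θ : Set (E p)) (prior : E p → ℝ)
    (g : E d → ℝ) (n : ℕ) (γ : ℝ) : ℝ :=
  jointFisherDivergence (fun y : Fin n → E d => ∏ i, g (y i)) (marginal f Θ prior γ)

/-- The Fisher divergence per observation, `𝓙(γ) = lim_n n⁻¹ 𝓙_n(γ)` with `𝓙_n` the Fisher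
divergence between the density of `n` observations and the `γ`-marginal. -/
def fisherRate {p d : ℕ} (f : E p → E d → ℝ) (Θ : Set (E p)) (prior : E p → ℝ)
    (g : E d → ℝ) (γ : ℝ) : ℝ :=
  limUnder atTop (fun n : ℕ => marginalFisher f Θ prior g n γ / n)

/-- The regularity conditions on the model `f`, the parameter set `Θ`, the prior density, the
data-generating density `g` and the set `Γ` of tuning parameters. -/
structure Regular {p d : ℕ} (f : E p → E d → ℝ) (Θ : Set (E p)) (prior : E p → ℝ)
    (g : E d → ℝ) (Γ : Set ℝ) : Prop where
  /-- The tuning parameter ranges over a compact set of positive numbers. -/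
  isCompact_tuning : IsCompact Γ
  tuning_pos : ∀ γ ∈ Γ, 0 < γ
  /-- `g` is a continuously differentiable density with finite Fisher information. -/
  data_nonneg : ∀ y, 0 ≤ g y
  data_integral : ∫ y, g y = 1
  data_contDiff : ContDiff ℝ 1 g
  data_fisher : ∀ k : Fin d, Integrable (fun y => (pderiv k (fun z => log (g z)) y) ^ 2 * g y)
  /-- The prior is a density on `Θ`. -/
  measurableSet_param : MeasurableSet Θ
  prior_nonneg : ∀ θ ∈ Θ, 0 ≤ prior θ
  prior_integral : ∫ θ in Θ, prior θ = 1
  /-- The model consists of positive, twice continuously differentiable densities. -/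
  model_pos : ∀ θ ∈ Θ, ∀ y, 0 < f θ y
  model_integral : ∀ θ ∈ Θ, ∫ y, f θ y = 1
  model_contDiff : ∀ θ ∈ Θ, ContDiff ℝ 2 (f θ)
  /-- The densities and their derivatives in `y` are continuous in `(θ, y)`. -/
  model_continuous : ContinuousOn (fun q : E p × E d => f q.1 q.2) (Θ ×ˢ univ)
  model_continuous₁ : ∀ k : Fin d,
    ContinuousOn (fun q : E p × E d => pderiv k (f q.1) q.2) (Θ ×ˢ univ)
  model_continuous₂ : ∀ k : Fin d,
    ContinuousOn (fun q : E p × E d => pderiv k (pderiv k (f q.1)) q.2) (Θ ×ˢ univ)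
  /-- The integral in the density power divergence is finite, and continuous in `(γ, θ)`. -/
  power_integrable : ∀ γ ∈ Γ, ∀ θ ∈ Θ, Integrable (fun x => f θ x ^ (1 + γ))
  power_continuous : ContinuousOn (fun q : ℝ × E p => ∫ x, f q.2 x ^ (1 + q.1)) (Γ ×ˢ Θ)
  /-- The log pseudo-likelihood, the squares of its first derivatives and its second derivatives
  in `y` have a common continuous envelope that is integrable under the data. -/
  envelope : ∃ h : E d → ℝ, Continuous h ∧ Integrable (fun y => h y * g y) ∧
    ∀ γ ∈ Γ, ∀ θ ∈ Θ, ∀ y, |logLik f γ y θ| ≤ h y ∧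
      ∀ k : Fin d, (pderiv k (fun z => logLik f γ z θ) y) ^ 2 ≤ h y ∧
        |pderiv k (pderiv k (fun z => logLik f γ z θ)) y| ≤ h y

/-- `θstar γ` is the identifiable target of the general posterior with tuning parameter `γ`. -/
structure Identified {p d : ℕ} (f : E p → E d → ℝ) (Θ : Set (E p)) (prior : E p → ℝ)
    (g : E d → ℝ) (Γ : Set ℝ) (θstar : ℝ → E p) : Prop where
  mem : ∀ γ ∈ Γ, θstar γ ∈ Θ
  /-- `θstar γ` is the unique maximiser over `Θ` of the expected log pseudo-likelihood. -/
  unique_max : ∀ γ ∈ Γ, ∀ θ ∈ Θ, θ ≠ θstar γ →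
    ∫ y, logLik f γ y θ * g y < ∫ y, logLik f γ y (θstar γ) * g y
  /-- The prior charges every neighbourhood of `θstar γ`. -/
  prior_pos : ∀ γ ∈ Γ, ∀ ε > 0, 0 < ∫ θ in Θ ∩ Metric.ball (θstar γ) ε, prior θ
  /-- Parameters outside some compact set are worse than `θstar γ` in expectation, uniformly
  (no condition when `Θ` is compact). -/
  tail : ∃ (K : Set (E p)) (u : E d → ℝ), IsCompact K ∧ K ⊆ Θ ∧
    Integrable (fun y => u y * g y) ∧ ∫ y, u y * g y < 0 ∧
    ∀ γ ∈ Γ, ∀ θ ∈ Θ, θ ∉ K → ∀ y, logLik f γ y θ - logLik f γ y (θstar γ) ≤ u y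

end RobustBayes

end

open RobustBayes

/-! Write L for the log pseudo-likelihood, s for its gradient in the observation, and M(γ,θ) for the
mean of L under g (`expLogLik`). Three facts carry the theorem.

Tilting. The posterior is the prior exponentially tilted by the sum of the L(y_j), so tilting the
leave-one-out posterior by L(y_i) gives the full posterior (`Regular.tilted_loo`). Differentiating
the logarithm of a mixture under the integral produces expectations under exactly this tilt. Hence
the leave-one-out score consists of full-posterior expectations (`Regular.looScore_eq_hScore`), and
the gradient of the log evidence in y_i is the posterior mean of s(y_i).

Concentration. A law of large numbers in the space of continuous functions on Γ × K
(`tendstoUniformlyOn_average`), the tail bound outside K, and compactness make the posterior mass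
away from `θstar γ` vanish uniformly in γ (`TailBound.concentrates`). Posterior means of s then
converge to s at the target. By exchangeability the Fisher divergence per observation is the mean
contribution of one observation, so dominated convergence gives its limit
(`Identified.tendsto_marginalFisher`). In the same way the score per observation converges almost
surely to the expected Hyvärinen score at the target (`Identified.ae_tendsto_hScore`).

Integration by parts. The cross term of the Fisher divergence at the target equals minus the mean
second derivative of L, so the limit of the divergence and the limit of the score differ by a
constant free of γ (`Regular.integral_targetGap`). Uniform convergence on the compact Γ then forces
minimisers of the score to the unique minimiser of the divergence (`tendsto_of_isMinOn`).

Uniformity in γ is expressed throughout by convergence along `atTop ×ˢ 𝓟 Γ`. -/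

noncomputable section

namespace RobustBayes

/-! ### Partial derivatives as line derivatives. -/

section PartialDerivatives

variable {d : ℕ} {F : E d → ℝ} {y : E d} {k : Fin d}

lemma pderiv_eq_fderiv (h : DifferentiableAt ℝ F y) :
    pderiv k F y = fderiv ℝ F y (EuclideanSpace.single k 1) :=
  h.lineDeriv_eq_fderiv

lemma hasLineDerivAt_pderiv (h : DifferentiableAt ℝ F y) :
    HasLineDerivAt ℝ F (pderiv k F y) y (EuclideanSpace.single k 1) :=
  h.lineDifferentiableAt.hasLineDerivAt

lemma contDiff_pderiv (h : ContDiff ℝ 2 F) : ContDiff ℝ 1 (pderiv k F) := by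
  have h1 : pderiv k F = fun y => fderiv ℝ F y (EuclideanSpace.single k 1) :=
    funext fun y => pderiv_eq_fderiv (h.differentiable (by norm_num) y)
  rw [h1]
  exact (h.fderiv_right (by norm_num)).clm_apply contDiff_const

lemma continuous_pderiv (h : ContDiff ℝ 1 F) : Continuous (pderiv k F) := by
  have h1 : pderiv k F = fun y => fderiv ℝ F y (EuclideanSpace.single k 1) :=
    funext fun y => pderiv_eq_fderiv (h.differentiable (by norm_num) y)
  rw [h1]
  exact (h.continuous_fderiv (by norm_num)).clm_apply continuous_const

/-- A line derivative at a point is a derivative along the whole line. -/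
lemma hasDerivAt_line {F' : E d → ℝ} {v : E d} (h : ∀ z, HasLineDerivAt ℝ F (F' z) z v)
    (y : E d) (t : ℝ) : HasDerivAt (fun s : ℝ => F (y + s • v)) (F' (y + t • v)) t := by
  have h1 : HasDerivAt (fun s : ℝ => F (y + t • v + s • v)) (F' (y + t • v)) 0 := h (y + t • v)
  have h2 : HasDerivAt (fun s : ℝ => s - t) 1 t := (hasDerivAt_id t).sub_const t
  have h3 := HasDerivAt.comp t (h₂ := fun s : ℝ => F (y + t • v + s • v)) (h := fun s => s - t)
    (h₂' := F' (y + t • v)) (by simpa using h1) h2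
  simp only [mul_one] at h3
  refine h3.congr_of_eventuallyEq (Eventually.of_forall fun s => ?_)
  simp only [Function.comp]
  congr 1
  rw [add_assoc, ← add_smul]
  congr 2
  ring

end PartialDerivatives

/-! ### Derivatives of the log pseudo-likelihood and their joint continuity. -/

section Model

variable {p d : ℕ} {f : E p → E d → ℝ} {Θ : Set (E p)} {prior : E p → ℝ} {g : E d → ℝ}
  {Γ : Set ℝ} {γ : ℝ} {θ : E p}

/-- The partial derivative of `log 𝓛_γ(y; θ)` in the `k`-th coordinate of `y`. -/
def score (f : E p → E d → ℝ) (k : Fin d) (γ : ℝ) (y : E d) (θ : E p) : ℝ :=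
  pderiv k (fun z => logLik f γ z θ) y

/-- The second partial derivative of `log 𝓛_γ(y; θ)` in the `k`-th coordinate of `y`. -/
def score₂ (f : E p → E d → ℝ) (k : Fin d) (γ : ℝ) (y : E d) (θ : E p) : ℝ :=
  pderiv k (pderiv k (fun z => logLik f γ z θ)) y

lemma Regular.contDiff_logLik (hreg : Regular f Θ prior g Γ) (γ : ℝ) (hθ : θ ∈ Θ) :
    ContDiff ℝ 2 (fun z => logLik f γ z θ) :=
  (contDiff_const.mul ((hreg.model_contDiff θ hθ).rpow_const_of_ne
    fun y => (hreg.model_pos θ hθ y).ne')).sub contDiff_const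

lemma Regular.hasLineDerivAt_logLik (hreg : Regular f Θ prior g Γ) (γ : ℝ) (hθ : θ ∈ Θ)
    (k : Fin d) (z : E d) :
    HasLineDerivAt ℝ (fun z => logLik f γ z θ) (score f k γ z θ) z (EuclideanSpace.single k 1) :=
  hasLineDerivAt_pderiv ((hreg.contDiff_logLik γ hθ).differentiable (by norm_num) z)

lemma Regular.hasLineDerivAt_score (hreg : Regular f Θ prior g Γ) (γ : ℝ) (hθ : θ ∈ Θ)
    (k : Fin d) (z : E d) :
    HasLineDerivAt ℝ (fun z => score f k γ z θ) (score₂ f k γ z θ) z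
      (EuclideanSpace.single k 1) :=
  hasLineDerivAt_pderiv
    ((contDiff_pderiv (hreg.contDiff_logLik γ hθ)).differentiable (by norm_num) z)

/-- The integral of the power of the density does not depend on the observation and drops out. This
closed form, like the one for `score₂`, reduces joint continuity in (γ, θ, y) to that of the density
and its derivatives. -/
lemma Regular.score_eq (hreg : Regular f Θ prior g Γ) (hγ : 0 < γ) (hθ : θ ∈ Θ)
    (k : Fin d) (z : E d) :
    score f k γ z θ = f θ z ^ (γ - 1) * pderiv k (f θ) z := by
  have h0 := hasLineDerivAt_pderiv (k := k)
    ((hreg.model_contDiff θ hθ).differentiable (by norm_num) z)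
  have h1 : HasLineDerivAt ℝ (fun z => logLik f γ z θ)
      (1 / γ * (pderiv k (f θ) z * γ * f θ z ^ (γ - 1))) z (EuclideanSpace.single k 1) := by
    have := HasDerivAt.rpow_const (p := γ) h0 (Or.inl (by simpa using (hreg.model_pos θ hθ z).ne'))
    simp only [zero_smul, add_zero] at this
    exact (this.const_mul (1 / γ)).sub_const _
  rw [(hreg.hasLineDerivAt_logLik γ hθ k z).unique h1]
  field_simp

lemma Regular.score₂_eq (hreg : Regular f Θ prior g Γ) (hγ : 0 < γ) (hθ : θ ∈ Θ)
    (k : Fin d) (z : E d) :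
    score₂ f k γ z θ = (γ - 1) * f θ z ^ (γ - 2) * pderiv k (f θ) z ^ 2
      + f θ z ^ (γ - 1) * pderiv k (pderiv k (f θ)) z := by
  have h0 := hasLineDerivAt_pderiv (k := k)
    ((hreg.model_contDiff θ hθ).differentiable (by norm_num) z)
  have h1 := hasLineDerivAt_pderiv (k := k)
    ((contDiff_pderiv (k := k) (hreg.model_contDiff θ hθ)).differentiable (by norm_num) z)
  have h2 : HasLineDerivAt ℝ (fun z => f θ z ^ (γ - 1) * pderiv k (f θ) z)
      (pderiv k (f θ) z * (γ - 1) * f θ z ^ (γ - 1 - 1) * pderiv k (f θ) z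
        + f θ z ^ (γ - 1) * pderiv k (pderiv k (f θ)) z) z (EuclideanSpace.single k 1) := by
    have := HasDerivAt.rpow_const (p := γ - 1) h0
      (Or.inl (by simpa using (hreg.model_pos θ hθ z).ne'))
    have := this.mul h1
    simp only [zero_smul, add_zero] at this
    exact this
  have h3 := hreg.hasLineDerivAt_score γ hθ k z
  rw [show (fun z => score f k γ z θ) = fun z => f θ z ^ (γ - 1) * pderiv k (f θ) z from
    funext fun z => hreg.score_eq hγ hθ k z] at h3
  rw [h3.unique h2, show γ - 1 - 1 = γ - 2 by ring]
  ring

lemma Regular.continuousOn_logLik (hreg : Regular f Θ prior g Γ) :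
    ContinuousOn (fun q : ℝ × E p × E d => logLik f q.1 q.2.2 q.2.1) (Γ ×ˢ Θ ×ˢ univ) := by
  have hf : ContinuousOn (fun q : ℝ × E p × E d => f q.2.1 q.2.2) (Γ ×ˢ Θ ×ˢ univ) :=
    hreg.model_continuous.comp continuousOn_snd fun q hq => hq.2
  have hI : ContinuousOn (fun q : ℝ × E p × E d => ∫ x, f q.2.1 x ^ (1 + q.1))
      (Γ ×ˢ Θ ×ˢ univ) :=
    hreg.power_continuous.comp (f := fun q : ℝ × E p × E d => (q.1, q.2.1))
      (by fun_prop) fun q hq => ⟨hq.1, hq.2.1⟩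
  have hγ : ∀ q ∈ Γ ×ˢ Θ ×ˢ (univ : Set (E d)), 0 < q.1 := fun q hq => hreg.tuning_pos _ hq.1
  refine ContinuousOn.sub (ContinuousOn.mul ?_ (hf.rpow continuousOn_fst fun q hq =>
    Or.inr (hγ q hq))) (ContinuousOn.mul ?_ hI)
  · exact continuousOn_const.div continuousOn_fst fun q hq => (hγ q hq).ne'
  · exact continuousOn_const.div (continuousOn_const.add continuousOn_fst)
      fun q hq => (add_pos one_pos (hγ q hq)).ne'

lemma Regular.continuousOn_score (hreg : Regular f Θ prior g Γ) (k : Fin d) :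
    ContinuousOn (fun q : ℝ × E p × E d => score f k q.1 q.2.2 q.2.1) (Γ ×ˢ Θ ×ˢ univ) := by
  have hf : ContinuousOn (fun q : ℝ × E p × E d => f q.2.1 q.2.2) (Γ ×ˢ Θ ×ˢ univ) :=
    hreg.model_continuous.comp continuousOn_snd fun q hq => hq.2
  have hf₁ : ContinuousOn (fun q : ℝ × E p × E d => pderiv k (f q.2.1) q.2.2) (Γ ×ˢ Θ ×ˢ univ) :=
    (hreg.model_continuous₁ k).comp continuousOn_snd fun q hq => hq.2
  refine ((hf.rpow (continuousOn_fst.sub (continuousOn_const (c := (1 : ℝ)))) fun q hq =>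
    Or.inl (hreg.model_pos _ hq.2.1 _).ne').mul hf₁).congr fun q hq => ?_
  exact hreg.score_eq (hreg.tuning_pos _ hq.1) hq.2.1 k _

lemma Regular.continuousOn_score₂ (hreg : Regular f Θ prior g Γ) (k : Fin d) :
    ContinuousOn (fun q : ℝ × E p × E d => score₂ f k q.1 q.2.2 q.2.1) (Γ ×ˢ Θ ×ˢ univ) := by
  have hf : ContinuousOn (fun q : ℝ × E p × E d => f q.2.1 q.2.2) (Γ ×ˢ Θ ×ˢ univ) :=
    hreg.model_continuous.comp continuousOn_snd fun q hq => hq.2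
  have hf₁ : ContinuousOn (fun q : ℝ × E p × E d => pderiv k (f q.2.1) q.2.2) (Γ ×ˢ Θ ×ˢ univ) :=
    (hreg.model_continuous₁ k).comp continuousOn_snd fun q hq => hq.2
  have hf₂ : ContinuousOn (fun q : ℝ × E p × E d => pderiv k (pderiv k (f q.2.1)) q.2.2)
      (Γ ×ˢ Θ ×ˢ univ) :=
    (hreg.model_continuous₂ k).comp continuousOn_snd fun q hq => hq.2
  have hr : ∀ c : ℝ, ContinuousOn (fun q : ℝ × E p × E d => f q.2.1 q.2.2 ^ (q.1 - c))
      (Γ ×ˢ Θ ×ˢ univ) := fun c => hf.rpow (continuousOn_fst.sub continuousOn_const) fun q hq =>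
    Or.inl (hreg.model_pos _ hq.2.1 _).ne'
  refine ((((continuousOn_fst.sub (continuousOn_const (c := (1 : ℝ)))).mul (hr 2)).mul
    (hf₁.pow 2)).add ((hr 1).mul hf₂)).congr fun q hq => ?_
  exact hreg.score₂_eq (hreg.tuning_pos _ hq.1) hq.2.1 k _

end Model

/-! ### The integrable envelope. -/

section Envelope

/-- A nonnegative continuous function that dominates the log pseudo-likelihood, the squares of its
first derivatives and its second derivatives, uniformly in the parameters. -/
structure IsEnvelope {p d : ℕ} (f : E p → E d → ℝ) (Θ : Set (E p)) (Γ : Set ℝ)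
    (h : E d → ℝ) : Prop where
  continuous : Continuous h
  nonneg : ∀ y, 0 ≤ h y
  abs_logLik_le : ∀ γ ∈ Γ, ∀ θ ∈ Θ, ∀ y, |logLik f γ y θ| ≤ h y
  score_sq_le : ∀ γ ∈ Γ, ∀ θ ∈ Θ, ∀ y k, score f k γ y θ ^ 2 ≤ h y
  abs_score₂_le : ∀ γ ∈ Γ, ∀ θ ∈ Θ, ∀ y k, |score₂ f k γ y θ| ≤ h y

variable {p d : ℕ} {f : E p → E d → ℝ} {Θ : Set (E p)} {prior : E p → ℝ} {g h : E d → ℝ}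
  {Γ : Set ℝ} {γ : ℝ} {θ : E p}

/-- The absolute value of the given envelope is nonnegative even where its bounds are vacuous, and
stays integrable because `g` is nonnegative. -/
lemma Regular.exists_isEnvelope (hreg : Regular f Θ prior g Γ) :
    ∃ h : E d → ℝ, IsEnvelope f Θ Γ h ∧ Integrable (fun y => h y * g y) := by
  obtain ⟨h, hc, hi, hb⟩ := hreg.envelope
  refine ⟨fun y => |h y|, ⟨hc.abs, fun y => abs_nonneg _, fun γ hγ θ hθ y => ?_,
    fun γ hγ θ hθ y k => ?_, fun γ hγ θ hθ y k => ?_⟩, ?_⟩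
  · exact (hb γ hγ θ hθ y).1.trans (le_abs_self _)
  · exact ((hb γ hγ θ hθ y).2 k).1.trans (le_abs_self _)
  · exact ((hb γ hγ θ hθ y).2 k).2.trans (le_abs_self _)
  · refine hi.norm.congr (Eventually.of_forall fun y => ?_)
    simp [abs_of_nonneg (hreg.data_nonneg y)]

lemma IsEnvelope.abs_score_le_sqrt (henv : IsEnvelope f Θ Γ h) (hγ : γ ∈ Γ) (hθ : θ ∈ Θ)
    (y : E d) (k : Fin d) : |score f k γ y θ| ≤ √(h y) :=
  Real.abs_le_sqrt (henv.score_sq_le γ hγ θ hθ y k)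

lemma IsEnvelope.sqrt_le (henv : IsEnvelope f Θ Γ h) (y : E d) : √(h y) ≤ 1 + h y := by
  nlinarith [Real.sq_sqrt (henv.nonneg y), sq_nonneg (√(h y) - 1), Real.sqrt_nonneg (h y)]

lemma IsEnvelope.abs_score_le (henv : IsEnvelope f Θ Γ h) (hγ : γ ∈ Γ) (hθ : θ ∈ Θ)
    (y : E d) (k : Fin d) : |score f k γ y θ| ≤ 1 + h y :=
  (henv.abs_score_le_sqrt hγ hθ y k).trans (henv.sqrt_le y)

lemma Regular.continuousOn_logLik_param (hreg : Regular f Θ prior g Γ) (hγ : γ ∈ Γ) (y : E d) :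
    ContinuousOn (fun θ => logLik f γ y θ) Θ :=
  hreg.continuousOn_logLik.comp (f := fun θ : E p => ((γ, θ, y) : ℝ × E p × E d))
    (by fun_prop) fun _ hθ => ⟨hγ, hθ, mem_univ _⟩

lemma Regular.continuousOn_score_param (hreg : Regular f Θ prior g Γ) (hγ : γ ∈ Γ) (y : E d)
    (k : Fin d) : ContinuousOn (fun θ => score f k γ y θ) Θ :=
  (hreg.continuousOn_score k).comp (f := fun θ : E p => ((γ, θ, y) : ℝ × E p × E d))
    (by fun_prop) fun _ hθ => ⟨hγ, hθ, mem_univ _⟩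

lemma Regular.continuousOn_score₂_param (hreg : Regular f Θ prior g Γ) (hγ : γ ∈ Γ) (y : E d)
    (k : Fin d) : ContinuousOn (fun θ => score₂ f k γ y θ) Θ :=
  (hreg.continuousOn_score₂ k).comp (f := fun θ : E p => ((γ, θ, y) : ℝ × E p × E d))
    (by fun_prop) fun _ hθ => ⟨hγ, hθ, mem_univ _⟩

end Envelope

/-! ### The prior as a probability measure. -/

section Prior

variable {p d : ℕ} {f : E p → E d → ℝ} {Θ : Set (E p)} {prior : E p → ℝ} {g h : E d → ℝ}
  {Γ : Set ℝ} {γ : ℝ} {θ : E p}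

/-- The prior as a measure on the whole space. -/
def priorMeasure (Θ : Set (E p)) (prior : E p → ℝ) : Measure (E p) :=
  (volume.restrict Θ).withDensity (fun θ => ENNReal.ofReal (prior θ))

/-- The Bochner integral of a non-integrable function is 0, so a total integral of 1 forces
integrability. -/
lemma Regular.integrableOn_prior (hreg : Regular f Θ prior g Γ) : IntegrableOn prior Θ := by
  by_contra hn
  have := hreg.prior_integral
  rw [integral_undef hn] at this
  exact zero_ne_one this

lemma Regular.ae_prior_nonneg (hreg : Regular f Θ prior g Γ) :
    ∀ᵐ θ ∂volume.restrict Θ, 0 ≤ prior θ :=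
  (ae_restrict_mem hreg.measurableSet_param).mono hreg.prior_nonneg

lemma Regular.isProbabilityMeasure_prior (hreg : Regular f Θ prior g Γ) :
    IsProbabilityMeasure (priorMeasure Θ prior) := by
  refine ⟨?_⟩
  rw [priorMeasure, withDensity_apply _ MeasurableSet.univ, Measure.restrict_univ,
    ← ofReal_integral_eq_lintegral_ofReal hreg.integrableOn_prior hreg.ae_prior_nonneg,
    hreg.prior_integral, ENNReal.ofReal_one]

lemma priorMeasure_absolutelyContinuous : priorMeasure Θ prior ≪ volume.restrict Θ :=
  withDensity_absolutelyContinuous _ _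

lemma Regular.ae_mem (hreg : Regular f Θ prior g Γ) : ∀ᵐ θ ∂priorMeasure Θ prior, θ ∈ Θ :=
  priorMeasure_absolutelyContinuous.ae_le (ae_restrict_mem hreg.measurableSet_param)

lemma Regular.integral_prior (hreg : Regular f Θ prior g Γ) (φ : E p → ℝ) :
    ∫ θ, φ θ ∂priorMeasure Θ prior = ∫ θ in Θ, φ θ * prior θ := by
  rw [priorMeasure, integral_withDensity_eq_integral_toReal_smul₀
    hreg.integrableOn_prior.aemeasurable.ennreal_ofReal (by simp)]
  refine integral_congr_ae (hreg.ae_prior_nonneg.mono fun θ hθ => ?_)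
  simp [ENNReal.toReal_ofReal hθ, mul_comm]

lemma Regular.aestronglyMeasurable_param (hreg : Regular f Θ prior g Γ) {ρ : Measure (E p)}
    (hρ : ρ ≪ priorMeasure Θ prior) {φ : E p → ℝ} (hφ : ContinuousOn φ Θ) :
    AEStronglyMeasurable φ ρ :=
  (hφ.aestronglyMeasurable hreg.measurableSet_param).mono_ac
    (hρ.trans priorMeasure_absolutelyContinuous)

lemma Regular.integrable_param (hreg : Regular f Θ prior g Γ) {ρ : Measure (E p)}
    [IsFiniteMeasure ρ] (hρ : ρ ≪ priorMeasure Θ prior) {φ : E p → ℝ} (hφ : ContinuousOn φ Θ)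
    {C : ℝ} (hC : ∀ θ ∈ Θ, |φ θ| ≤ C) : Integrable φ ρ :=
  .of_bound (hreg.aestronglyMeasurable_param hρ hφ) C
    (Eventually.mono (hρ.ae_le hreg.ae_mem) fun θ hθ => hC θ hθ)

/-- Continuity of an integral against the prior in a further parameter. -/
lemma Regular.continuousOn_integral_prior (hreg : Regular f Θ prior g Γ)
    {X : Type*} [TopologicalSpace X] [FirstCountableTopology X] {S : Set X} {φ : X → E p → ℝ}
    {C : X → ℝ} (h₁ : ∀ θ ∈ Θ, ContinuousOn (fun x => φ x θ) S)
    (h₂ : ∀ x ∈ S, ContinuousOn (φ x) Θ) (hC : ContinuousOn C S)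
    (hb : ∀ x ∈ S, ∀ θ ∈ Θ, |φ x θ| ≤ C x) :
    ContinuousOn (fun x => ∫ θ, φ x θ ∂priorMeasure Θ prior) S := by
  have := hreg.isProbabilityMeasure_prior
  intro x hx
  refine continuousWithinAt_of_dominated (bound := fun _ => C x + 1) ?_ ?_ (integrable_const _) ?_
  · filter_upwards [self_mem_nhdsWithin] with z hz
    exact hreg.aestronglyMeasurable_param Measure.AbsolutelyContinuous.rfl (h₂ z hz)
  -- Near `x` the bound `C` stays below the constant `C x + 1`, which is integrable for the finite
  -- prior measure.
  · filter_upwards [self_mem_nhdsWithin, (hC x hx).eventually_le_const (lt_add_one (C x))]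
      with z hz hz'
    exact hreg.ae_mem.mono fun θ hθ => (hb z hz θ hθ).trans hz'
  · exact hreg.ae_mem.mono fun θ hθ => h₁ θ hθ x hx

end Prior

/-! ### The posterior as an exponentially tilted prior. -/

section Posterior

variable {ι : Type} [Fintype ι] {p d : ℕ} {f : E p → E d → ℝ} {Θ : Set (E p)}
  {prior : E p → ℝ} {g h : E d → ℝ} {Γ : Set ℝ} {γ : ℝ} {θ : E p} {y : ι → E d}

/-- The general posterior as a measure on the whole space. -/
def postMeasure (f : E p → E d → ℝ) (Θ : Set (E p)) (prior : E p → ℝ) (γ : ℝ)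
    (y : ι → E d) : Measure (E p) :=
  (priorMeasure Θ prior).tilted (fun θ => ∑ j, logLik f γ (y j) θ)

lemma postMeasure_absolutelyContinuous : postMeasure f Θ prior γ y ≪ priorMeasure Θ prior :=
  tilted_absolutelyContinuous _ _

lemma Regular.ae_mem_post (hreg : Regular f Θ prior g Γ) :
    ∀ᵐ θ ∂postMeasure f Θ prior γ y, θ ∈ Θ :=
  postMeasure_absolutelyContinuous.ae_le hreg.ae_mem

lemma Regular.continuousOn_sum_logLik (hreg : Regular f Θ prior g Γ) (hγ : γ ∈ Γ)
    (y : ι → E d) : ContinuousOn (fun θ => ∑ j, logLik f γ (y j) θ) Θ :=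
  continuousOn_finsetSum _ fun j _ => hreg.continuousOn_logLik_param hγ (y j)

lemma IsEnvelope.abs_sum_logLik_le (henv : IsEnvelope f Θ Γ h) (hγ : γ ∈ Γ) (hθ : θ ∈ Θ)
    (y : ι → E d) : |∑ j, logLik f γ (y j) θ| ≤ ∑ j, h (y j) :=
  (Finset.abs_sum_le_sum_abs _ _).trans
    (Finset.sum_le_sum fun j _ => henv.abs_logLik_le γ hγ θ hθ (y j))

lemma Regular.integrable_lik (hreg : Regular f Θ prior g Γ) (hγ : γ ∈ Γ) (y : ι → E d) :
    Integrable (fun θ => exp (∑ j, logLik f γ (y j) θ)) (priorMeasure Θ prior) := by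
  have := hreg.isProbabilityMeasure_prior
  obtain ⟨h, henv, -⟩ := hreg.exists_isEnvelope
  refine hreg.integrable_param Measure.AbsolutelyContinuous.rfl
    (hreg.continuousOn_sum_logLik hγ y).rexp (C := exp (∑ j, h (y j))) fun θ hθ => ?_
  rw [abs_of_pos (exp_pos _)]
  exact exp_le_exp.2 ((le_abs_self _).trans (henv.abs_sum_logLik_le hγ hθ y))

lemma Regular.isProbabilityMeasure_post (hreg : Regular f Θ prior g Γ) (hγ : γ ∈ Γ)
    (y : ι → E d) : IsProbabilityMeasure (postMeasure f Θ prior γ y) := by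
  have := hreg.isProbabilityMeasure_prior
  exact isProbabilityMeasure_tilted (hreg.integrable_lik hγ y)

lemma Regular.marginal_eq (hreg : Regular f Θ prior g Γ) (γ : ℝ) (y : ι → E d) :
    marginal f Θ prior γ y = ∫ θ, exp (∑ j, logLik f γ (y j) θ) ∂priorMeasure Θ prior :=
  (hreg.integral_prior _).symm

lemma Regular.marginal_pos (hreg : Regular f Θ prior g Γ) (hγ : γ ∈ Γ) (y : ι → E d) :
    0 < marginal f Θ prior γ y := by
  have := hreg.isProbabilityMeasure_prior
  rw [hreg.marginal_eq]
  exact integral_exp_pos (hreg.integrable_lik hγ y)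

lemma integral_post (φ : E p → ℝ) :
    ∫ θ, φ θ ∂postMeasure f Θ prior γ y
      = (∫ θ, φ θ * exp (∑ j, logLik f γ (y j) θ) ∂priorMeasure Θ prior)
        / ∫ θ, exp (∑ j, logLik f γ (y j) θ) ∂priorMeasure Θ prior := by
  rw [postMeasure, integral_tilted, ← integral_div]
  congr with θ
  simp only [smul_eq_mul]
  ring

lemma Regular.postExp_eq (hreg : Regular f Θ prior g Γ) (γ : ℝ) (y : ι → E d) (φ : E p → ℝ) :
    postExp f Θ prior γ y φ = ∫ θ, φ θ ∂postMeasure f Θ prior γ y := by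
  rw [integral_post, ← hreg.marginal_eq, hreg.integral_prior, ← integral_div]
  unfold postExp posterior lik
  congr with θ
  ring

/-- Continuity of posterior expectations in the tuning parameter and the data. -/
lemma Regular.continuousOn_integral_post (hreg : Regular f Θ prior g Γ)
    {φ : ℝ → E p → (ι → E d) → ℝ} {C : (ι → E d) → ℝ}
    (hφ : ContinuousOn (fun q : ℝ × E p × (ι → E d) => φ q.1 q.2.1 q.2.2) (Γ ×ˢ Θ ×ˢ univ))
    (hC : Continuous C) (hb : ∀ γ ∈ Γ, ∀ θ ∈ Θ, ∀ y, |φ γ θ y| ≤ C y) :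
    ContinuousOn (fun q : ℝ × (ι → E d) => ∫ θ, φ q.1 θ q.2 ∂postMeasure f Θ prior q.1 q.2)
      (Γ ×ˢ univ) := by
  obtain ⟨h, henv, -⟩ := hreg.exists_isEnvelope
  have hL : ContinuousOn (fun q : ℝ × E p × (ι → E d) => ∑ j, logLik f q.1 (q.2.2 j) q.2.1)
      (Γ ×ˢ Θ ×ˢ univ) :=
    continuousOn_finsetSum _ fun j _ => hreg.continuousOn_logLik.comp
      (f := fun q : ℝ × E p × (ι → E d) => (q.1, q.2.1, q.2.2 j)) (by fun_prop)
      fun q hq => ⟨hq.1, hq.2.1, mem_univ _⟩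
  have h1 : ∀ θ ∈ Θ, ∀ ψ : ℝ × E p × (ι → E d) → ℝ, ContinuousOn ψ (Γ ×ˢ Θ ×ˢ univ) →
      ContinuousOn (fun q : ℝ × (ι → E d) => ψ (q.1, θ, q.2)) (Γ ×ˢ univ) := fun θ hθ ψ hψ =>
    hψ.comp (f := fun q : ℝ × (ι → E d) => (q.1, θ, q.2)) (by fun_prop)
      fun q hq => ⟨hq.1, hθ, mem_univ _⟩
  have h2 : ∀ q ∈ Γ ×ˢ (univ : Set (ι → E d)), ∀ ψ : ℝ × E p × (ι → E d) → ℝ,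
      ContinuousOn ψ (Γ ×ˢ Θ ×ˢ univ) → ContinuousOn (fun θ => ψ (q.1, θ, q.2)) Θ :=
    fun q hq ψ hψ => hψ.comp (f := fun θ : E p => (q.1, θ, q.2)) (by fun_prop)
      fun θ hθ => ⟨hq.1, hθ, mem_univ _⟩
  have hH : Continuous fun y : ι → E d => ∑ j, h (y j) :=
    continuous_finsetSum _ fun j _ => henv.continuous.comp (continuous_apply j)
  have hexp : ∀ γ ∈ Γ, ∀ θ ∈ Θ, ∀ y : ι → E d,
      exp (∑ j, logLik f γ (y j) θ) ≤ exp (∑ j, h (y j)) := fun γ hγ θ hθ y =>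
    exp_le_exp.2 ((le_abs_self _).trans (henv.abs_sum_logLik_le hγ hθ y))
  -- A posterior expectation is a quotient of two prior integrals; each is continuous by domination,
  -- and the denominator is the positive evidence.
  simp_rw [integral_post]
  refine ContinuousOn.div ?_ ?_ fun q hq => ?_
  · refine hreg.continuousOn_integral_prior (C := fun q => |C q.2| * exp (∑ j, h (q.2 j)))
      (fun θ hθ => h1 θ hθ _ (hφ.mul hL.rexp)) (fun q hq => h2 q hq _ (hφ.mul hL.rexp)) ?_ ?_
    · exact ((hC.abs.comp continuous_snd).mul (hH.comp continuous_snd).rexp).continuousOn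
    · intro q hq θ hθ
      rw [abs_mul, abs_of_pos (exp_pos _)]
      exact mul_le_mul ((hb _ hq.1 θ hθ _).trans (le_abs_self _)) (hexp _ hq.1 θ hθ _)
        (exp_pos _).le (abs_nonneg _)
  · refine hreg.continuousOn_integral_prior (C := fun q => exp (∑ j, h (q.2 j)))
      (fun θ hθ => h1 θ hθ _ hL.rexp) (fun q hq => h2 q hq _ hL.rexp) ?_ ?_
    · exact (hH.comp continuous_snd).rexp.continuousOn
    · intro q hq θ hθ
      rw [abs_of_pos (exp_pos _)]
      exact hexp _ hq.1 θ hθ _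
  · rw [← hreg.marginal_eq]
    exact (hreg.marginal_pos hq.1 q.2).ne'

end Posterior

/-! ### Derivatives and Hyvärinen score of mixtures of pseudo-likelihoods. -/

section Predictive

variable {p d : ℕ} {f : E p → E d → ℝ} {Θ : Set (E p)} {prior : E p → ℝ} {g h : E d → ℝ}
  {Γ : Set ℝ} {γ : ℝ} {ρ : Measure (E p)}

/-- Differentiation under an integral over the parameter. -/
lemma Regular.hasLineDerivAt_integral (hreg : Regular f Θ prior g Γ) [IsFiniteMeasure ρ]
    (hρ : ρ ≪ priorMeasure Θ prior) {a a' : E d → E p → ℝ} {C : E d → ℝ} {v : E d}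
    (hd : ∀ θ ∈ Θ, ∀ z, HasLineDerivAt ℝ (fun z => a z θ) (a' z θ) z v)
    (ha : ∀ z, ContinuousOn (a z) Θ) (ha' : ∀ z, ContinuousOn (a' z) Θ) (hC : Continuous C)
    (hb : ∀ θ ∈ Θ, ∀ z, |a z θ| ≤ C z) (hb' : ∀ θ ∈ Θ, ∀ z, |a' z θ| ≤ C z) (z : E d) :
    HasLineDerivAt ℝ (fun z => ∫ θ, a z θ ∂ρ) (∫ θ, a' z θ ∂ρ) z v := by
  have hmem : ∀ᵐ θ ∂ρ, θ ∈ Θ := hρ.ae_le hreg.ae_mem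
  have hCt : Continuous fun t : ℝ => C (z + t • v) := by fun_prop
  -- On this neighbourhood the derivative along the line has a bound free of both `t` and `θ`.
  have hs : {t : ℝ | C (z + t • v) < C z + 1} ∈ 𝓝 (0 : ℝ) :=
    (isOpen_Iio.preimage hCt).mem_nhds (by simp)
  have := (hasDerivAt_integral_of_dominated_loc_of_deriv_le (μ := ρ)
    (F := fun t θ => a (z + t • v) θ) (F' := fun t θ => a' (z + t • v) θ) (x₀ := (0 : ℝ))
    (bound := fun _ => C z + 1) hs
    (Eventually.of_forall fun t => hreg.aestronglyMeasurable_param hρ (ha _))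
    (hreg.integrable_param hρ (ha _) fun θ hθ => hb θ hθ _)
    (hreg.aestronglyMeasurable_param hρ (ha' _))
    (hmem.mono fun θ hθ t ht => (hb' θ hθ _).trans (le_of_lt ht)) (integrable_const _)
    (hmem.mono fun θ hθ t _ => hasDerivAt_line (fun z => hd θ hθ z) z t)).2
  simpa [HasLineDerivAt] using this

/-- The first two partial derivatives of `∫ 𝓛_γ(z; θ) dρ(θ)` in `z`. -/
lemma Regular.hasLineDerivAt_mixture (hreg : Regular f Θ prior g Γ) [IsFiniteMeasure ρ]
    (hρ : ρ ≪ priorMeasure Θ prior) (hγ : γ ∈ Γ) (k : Fin d) (z : E d) :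
    HasLineDerivAt ℝ (fun z => ∫ θ, exp (logLik f γ z θ) ∂ρ)
        (∫ θ, score f k γ z θ * exp (logLik f γ z θ) ∂ρ) z (EuclideanSpace.single k 1) ∧
      HasLineDerivAt ℝ (fun z => ∫ θ, score f k γ z θ * exp (logLik f γ z θ) ∂ρ)
        (∫ θ, (score₂ f k γ z θ + score f k γ z θ ^ 2) * exp (logLik f γ z θ) ∂ρ) z
        (EuclideanSpace.single k 1) := by
  obtain ⟨h, henv, -⟩ := hreg.exists_isEnvelope
  have hL := fun z => (hreg.continuousOn_logLik_param hγ z).rexp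
  have hS := fun z => hreg.continuousOn_score_param hγ z k
  have hS₂ := fun z => hreg.continuousOn_score₂_param hγ z k
  -- One bound serves all three integrands: the prefactors 1, `score` and `score₂ + score ^ 2` are
  -- at most `1 + 2 * h` in absolute value, and the exponential is at most `exp h`.
  have hC : Continuous fun z => (1 + 2 * h z) * exp (h z) := by
    have := henv.continuous; fun_prop
  have hle : ∀ θ ∈ Θ, ∀ z, exp (logLik f γ z θ) ≤ exp (h z) := fun θ hθ z =>
    exp_le_exp.2 ((le_abs_self _).trans (henv.abs_logLik_le γ hγ θ hθ z))
  have hmul : ∀ θ ∈ Θ, ∀ z, ∀ x : ℝ, |x| ≤ 1 + 2 * h z →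
      |x * exp (logLik f γ z θ)| ≤ (1 + 2 * h z) * exp (h z) := fun θ hθ z x hx => by
    rw [abs_mul, abs_of_pos (exp_pos _)]
    have := henv.nonneg z
    exact mul_le_mul hx (hle θ hθ z) (exp_pos _).le (by linarith)
  have hd : ∀ θ ∈ Θ, ∀ z, HasLineDerivAt ℝ (fun z => exp (logLik f γ z θ))
      (score f k γ z θ * exp (logLik f γ z θ)) z (EuclideanSpace.single k 1) :=
    fun θ hθ z => by
      have := HasDerivAt.exp (hreg.hasLineDerivAt_logLik γ hθ k z)
      simpa [mul_comm, HasLineDerivAt] using this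
  have hb₀ : ∀ θ ∈ Θ, ∀ z, |exp (logLik f γ z θ)| ≤ (1 + 2 * h z) * exp (h z) :=
    fun θ hθ z => by
      have := hmul θ hθ z 1 (by rw [abs_one]; have := henv.nonneg z; linarith)
      rwa [one_mul] at this
  have hb₁ : ∀ θ ∈ Θ, ∀ z, |score f k γ z θ * exp (logLik f γ z θ)|
      ≤ (1 + 2 * h z) * exp (h z) := fun θ hθ z =>
    hmul θ hθ z _ ((henv.abs_score_le hγ hθ z k).trans (by have := henv.nonneg z; linarith))
  have hb₂ : ∀ θ ∈ Θ, ∀ z, |(score₂ f k γ z θ + score f k γ z θ ^ 2) * exp (logLik f γ z θ)|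
      ≤ (1 + 2 * h z) * exp (h z) := fun θ hθ z => by
    refine hmul θ hθ z _ ((abs_add_le _ _).trans ?_)
    have h1 := henv.abs_score₂_le γ hγ θ hθ z k
    have h2 := henv.score_sq_le γ hγ θ hθ z k
    rw [abs_of_nonneg (sq_nonneg (score f k γ z θ))]
    linarith
  refine ⟨hreg.hasLineDerivAt_integral hρ hd hL (fun z => (hS z).mul (hL z)) hC hb₀ hb₁ z,
    hreg.hasLineDerivAt_integral hρ (fun θ hθ z => ?_) (fun z => (hS z).mul (hL z))
      (fun z => ((hS₂ z).add ((hS z).pow 2)).mul (hL z)) hC hb₁ hb₂ z⟩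
  have := HasDerivAt.mul (hreg.hasLineDerivAt_score γ hθ k z) (hd θ hθ z)
  simp only [zero_smul, add_zero] at this
  have e : (score₂ f k γ z θ + score f k γ z θ ^ 2) * exp (logLik f γ z θ)
      = score₂ f k γ z θ * exp (logLik f γ z θ)
        + score f k γ z θ * (score f k γ z θ * exp (logLik f γ z θ)) := by ring
  change HasDerivAt (fun t : ℝ => score f k γ (z + t • EuclideanSpace.single k (1 : ℝ)) θ
    * exp (logLik f γ (z + t • EuclideanSpace.single k (1 : ℝ)) θ))
    ((score₂ f k γ z θ + score f k γ z θ ^ 2) * exp (logLik f γ z θ)) (0 : ℝ)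
  rw [e]
  exact this

lemma Regular.integrable_exp_logLik (hreg : Regular f Θ prior g Γ) [IsFiniteMeasure ρ]
    (hρ : ρ ≪ priorMeasure Θ prior) (hγ : γ ∈ Γ) (z : E d) :
    Integrable (fun θ => exp (logLik f γ z θ)) ρ := by
  obtain ⟨h, henv, -⟩ := hreg.exists_isEnvelope
  refine hreg.integrable_param hρ (hreg.continuousOn_logLik_param hγ z).rexp (C := exp (h z))
    fun θ hθ => ?_
  rw [abs_of_pos (exp_pos _)]
  exact exp_le_exp.2 ((le_abs_self _).trans (henv.abs_logLik_le γ hγ θ hθ z))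

lemma integral_tilted_eq_div {α : Type*} [MeasurableSpace α] (ρ : Measure α) (L φ : α → ℝ) :
    ∫ θ, φ θ ∂ρ.tilted L = (∫ θ, φ θ * exp (L θ) ∂ρ) / ∫ θ, exp (L θ) ∂ρ := by
  rw [integral_tilted, ← integral_div]
  congr with θ
  simp only [smul_eq_mul]
  ring

/-- The logarithmic derivative is a weighted integral of the score divided by the integral of the
weights, and the weights are those of the tilted measure. -/
lemma Regular.hasLineDerivAt_log_mixture (hreg : Regular f Θ prior g Γ)
    [IsProbabilityMeasure ρ] (hρ : ρ ≪ priorMeasure Θ prior) (hγ : γ ∈ Γ) (k : Fin d)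
    (z : E d) :
    HasLineDerivAt ℝ (fun z => log (∫ θ, exp (logLik f γ z θ) ∂ρ))
      (∫ θ, score f k γ z θ ∂ρ.tilted (logLik f γ z)) z (EuclideanSpace.single k 1) := by
  have h1 := (hreg.hasLineDerivAt_mixture hρ hγ k z).1
  have h0 := (integral_exp_pos (hreg.integrable_exp_logLik hρ hγ z)).ne'
  have := HasDerivAt.log h1 (by simpa using h0)
  simp only [zero_smul, add_zero] at this
  rw [integral_tilted_eq_div]
  exact this

/-- The Hyvärinen score of a mixture of pseudo-likelihoods. -/
lemma Regular.hyvarinenScore_mixture (hreg : Regular f Θ prior g Γ)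
    [IsProbabilityMeasure ρ] (hρ : ρ ≪ priorMeasure Θ prior) (hγ : γ ∈ Γ) (z : E d) :
    hyvarinenScore z (fun z => ∫ θ, exp (logLik f γ z θ) ∂ρ)
      = ∑ k, (2 * ∫ θ, (score₂ f k γ z θ + score f k γ z θ ^ 2) ∂ρ.tilted (logLik f γ z)
          - (∫ θ, score f k γ z θ ∂ρ.tilted (logLik f γ z)) ^ 2) := by
  refine Finset.sum_congr rfl fun k _ => ?_
  have h0 := fun z => (integral_exp_pos (hreg.integrable_exp_logLik hρ hγ z)).ne'
  have h1 : pderiv k (fun z => log (∫ θ, exp (logLik f γ z θ) ∂ρ))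
      = fun z => (∫ θ, score f k γ z θ * exp (logLik f γ z θ) ∂ρ)
        / ∫ θ, exp (logLik f γ z θ) ∂ρ := by
    funext z
    rw [← integral_tilted_eq_div]
    exact (hreg.hasLineDerivAt_log_mixture hρ hγ k z).lineDeriv
  obtain ⟨h2, h3⟩ := hreg.hasLineDerivAt_mixture hρ hγ k z
  -- With M the mixture, the quotient rule gives (log M)'' = M''/M - (M'/M)², so 2(log M)'' + ((log
  -- M)')² = 2M''/M - (M'/M)².
  have h4 := HasDerivAt.div h3 h2 (by simpa using h0 z)
  simp only [zero_smul, add_zero] at h4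
  have h5 : pderiv k (fun z => (∫ θ, score f k γ z θ * exp (logLik f γ z θ) ∂ρ)
        / ∫ θ, exp (logLik f γ z θ) ∂ρ) z = _ := HasLineDerivAt.lineDeriv h4
  rw [h1, h5, integral_tilted_eq_div, integral_tilted_eq_div]
  have := h0 z
  field_simp
  ring

end Predictive

/-! ### The leave-one-out identity and the gradient of the log evidence. -/

section LeaveOneOut

variable {n p d : ℕ} {f : E p → E d → ℝ} {Θ : Set (E p)} {prior : E p → ℝ} {g h : E d → ℝ}
  {Γ : Set ℝ} {γ : ℝ}

lemma sum_erase_add {φ : Fin n → ℝ} (i : Fin n) :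
    ∑ j : {j : Fin n // j ≠ i}, φ j + φ i = ∑ j, φ j := by
  rw [← Finset.sum_subtype (s := Finset.univ.erase i) (p := fun j => j ≠ i) (by simp) φ,
    Finset.sum_erase_add _ _ (Finset.mem_univ i)]

/-- Updating the leave-one-out posterior with the omitted observation gives the posterior. -/
lemma Regular.tilted_loo (hreg : Regular f Θ prior g Γ) (hγ : γ ∈ Γ) (y : Fin n → E d)
    (i : Fin n) :
    (postMeasure f Θ prior γ (fun j : {j : Fin n // j ≠ i} => y j)).tilted (logLik f γ (y i))
      = postMeasure f Θ prior γ y := by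
  rw [postMeasure, tilted_tilted (hreg.integrable_lik hγ _), postMeasure]
  congr 1
  funext θ
  exact sum_erase_add (φ := fun j => logLik f γ (y j) θ) i

lemma Regular.looPredictive_eq (hreg : Regular f Θ prior g Γ) (γ : ℝ) (y : Fin n → E d)
    (i : Fin n) :
    looPredictive f Θ prior γ y i = fun z => ∫ θ, exp (logLik f γ z θ)
      ∂postMeasure f Θ prior γ (fun j : {j : Fin n // j ≠ i} => y j) :=
  funext fun _ => hreg.postExp_eq _ _ _

/-- The leave-one-out Hyvärinen score in terms of the full posterior. -/
theorem Regular.looScore_eq_hScore (hreg : Regular f Θ prior g Γ) (hγ : γ ∈ Γ)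
    (y : Fin n → E d) : looScore f Θ prior γ y = hScore f Θ prior γ y := by
  refine Finset.sum_congr rfl fun i _ => ?_
  have := hreg.isProbabilityMeasure_post hγ (fun j : {j : Fin n // j ≠ i} => y j)
  rw [hreg.looPredictive_eq,
    hreg.hyvarinenScore_mixture postMeasure_absolutelyContinuous hγ, hreg.tilted_loo hγ]
  refine Finset.sum_congr rfl fun k _ => ?_
  rw [hreg.postExp_eq, hreg.postExp_eq]
  rfl

/-- The gradient of the log evidence is the posterior expectation of the score. -/
lemma Regular.jointPderiv_log_marginal (hreg : Regular f Θ prior g Γ) (hγ : γ ∈ Γ)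
    (y : Fin n → E d) (i : Fin n) (k : Fin d) :
    jointPderiv i k (fun z => log (marginal f Θ prior γ z)) y
      = ∫ θ, score f k γ (y i) θ ∂postMeasure f Θ prior γ y := by
  set y' : {j : Fin n // j ≠ i} → E d := fun j => y j with hy'
  have := hreg.isProbabilityMeasure_post hγ y'
  have h1 := hreg.hasLineDerivAt_log_mixture (ρ := postMeasure f Θ prior γ y')
    postMeasure_absolutelyContinuous hγ k (y i)
  rw [hreg.tilted_loo hγ] at h1
  have hm := hreg.marginal_pos hγ y'
  -- Only the `i`-th observation moves, so the evidence factors into the fixed evidence of the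
  -- others and the leave-one-out predictive at the moving point.
  have h2 : ∀ t : ℝ, log (marginal f Θ prior γ
      (y + t • (Pi.single i (EuclideanSpace.single k 1) : Fin n → E d)))
      = log (marginal f Θ prior γ y') + log (∫ θ, exp (logLik f γ
        (y i + t • EuclideanSpace.single k 1) θ) ∂postMeasure f Θ prior γ y') := by
    intro t
    have hpos := integral_exp_pos (hreg.integrable_exp_logLik
      (ρ := postMeasure f Θ prior γ y') postMeasure_absolutelyContinuous hγ
      (y i + t • EuclideanSpace.single k 1))
    rw [← log_mul hm.ne' hpos.ne', integral_post, ← hreg.marginal_eq, mul_div_cancel₀ _ hm.ne',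
      hreg.marginal_eq]
    congr 2 with θ
    rw [← exp_add, ← sum_erase_add i]
    congr 1
    rw [add_comm]
    congr 1
    · simp
    · refine Finset.sum_congr rfl fun j _ => ?_
      simp [hy', Pi.single_eq_of_ne j.2]
  refine HasLineDerivAt.lineDeriv (f := fun z => log (marginal f Θ prior γ z)) ?_
  unfold HasLineDerivAt
  simp_rw [h2]
  exact HasDerivAt.const_add _ h1

end LeaveOneOut

/-! ### Laws of large numbers. -/

section UniformLaw

variable {Ω T X : Type*} [MeasurableSpace Ω] {P : Measure Ω} [MeasurableSpace X] {μ : Measure X}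
  {Y : ℕ → Ω → X}

/-- A uniform law of large numbers over a compact parameter set. -/
theorem tendstoUniformlyOn_average [TopologicalSpace T] [TopologicalSpace X]
    [SecondCountableTopology X] [BorelSpace X] (hlaw : ∀ i, HasLaw (Y i) μ P)
    (hindep : iIndepFun Y P) {C : Set T} (hC : IsCompact C) {φ : T → X → ℝ}
    (hφ : ContinuousOn (fun q : T × X => φ q.1 q.2) (C ×ˢ univ)) {H : X → ℝ}
    (hH : Integrable H μ) (hb : ∀ t ∈ C, ∀ x, |φ t x| ≤ H x) :
    ∀ᵐ ω ∂P, TendstoUniformlyOn (fun (n : ℕ) t => (n : ℝ)⁻¹ * ∑ i : Fin n, φ t (Y i ω))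
      (fun t => ∫ x, φ t x ∂μ) atTop C := by
  -- A point of `C` is what shows that `H` is nonnegative, as needed to bound the sup norm.
  rcases C.eq_empty_or_nonempty with rfl | ⟨t₀, ht₀⟩
  · exact Eventually.of_forall fun _ => tendstoUniformlyOn_empty
  have : CompactSpace C := isCompact_iff_compactSpace.1 hC
  let mC : MeasurableSpace C(C, ℝ) := borel _
  have : BorelSpace C(C, ℝ) := ⟨rfl⟩
  have hcont : Continuous fun q : X × C => φ q.2 q.1 :=
    hφ.comp_continuous (f := fun q : X × C => ((q.2 : T), q.1)) (by fun_prop)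
      fun q => ⟨q.2.2, mem_univ _⟩
  -- Each observation becomes a random element of the Banach space of continuous functions on `C`.
  -- The strong law there is convergence in sup norm, that is, the uniform law.
  let Φ : X → C(C, ℝ) := fun x => ⟨fun t => φ t x, hcont.comp (Continuous.prodMk_right x)⟩
  have hΦ : Continuous Φ := ContinuousMap.continuous_of_continuous_uncurry _ hcont
  have hΦi : Integrable Φ μ := by
    refine hH.mono' hΦ.stronglyMeasurable.aestronglyMeasurable (Eventually.of_forall fun x => ?_)
    exact (ContinuousMap.norm_le _ ((abs_nonneg _).trans (hb t₀ ht₀ x))).2 fun t => hb t t.2 x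
  have hmap : ∀ i, P.map (Y i) = μ := fun i => (hlaw i).map_eq
  have hint : Integrable (fun ω => Φ (Y 0 ω)) P :=
    (integrable_map_measure (f := Y 0) (by rw [hmap]; exact hΦi.aestronglyMeasurable)
      (hlaw 0).aemeasurable).1 (by rwa [hmap])
  have hlln := strong_law_ae (μ := P) (fun i ω => Φ (Y i ω)) hint
    (fun i j hij => (hindep.indepFun hij).comp hΦ.measurable hΦ.measurable)
    (fun i => (IdentDistrib.mk (hlaw i).aemeasurable (hlaw 0).aemeasurable
      ((hmap i).trans (hmap 0).symm)).comp hΦ.measurable)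
  have hmean : ∫ ω, Φ (Y 0 ω) ∂P = ∫ x, Φ x ∂μ := by
    rw [← hmap 0, integral_map (hlaw 0).aemeasurable hΦ.aestronglyMeasurable]
  filter_upwards [hlln] with ω hω
  rw [hmean, ContinuousMap.tendsto_iff_tendstoUniformly] at hω
  rw [tendstoUniformlyOn_iff_tendstoUniformly_comp_coe]
  convert hω using 2 with n
  · funext t
    simp only [ContinuousMap.smul_apply, ContinuousMap.sum_apply, smul_eq_mul,
      Finset.sum_range]
    rfl
  · funext t
    simp only [Function.comp]
    rw [ContinuousMap.integral_apply hΦi]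
    rfl

/-- The strong law of large numbers for averages of a function of i.i.d. observations. -/
theorem tendsto_average (hlaw : ∀ i, HasLaw (Y i) μ P) (hindep : iIndepFun Y P)
    {φ : X → ℝ} (hφ : Integrable φ μ) :
    ∀ᵐ ω ∂P, Tendsto (fun n : ℕ => (n : ℝ)⁻¹ * ∑ i : Fin n, φ (Y i ω)) atTop
      (𝓝 (∫ x, φ x ∂μ)) := by
  -- Composition with `Y i` needs a genuinely measurable function. The version `ψ` agrees with `φ`
  -- at all the countably many observations almost surely.
  obtain ⟨ψ, hψ, hae⟩ := hφ.aestronglyMeasurable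
  have hψi : Integrable ψ μ := hφ.congr hae
  have hmap : ∀ i, P.map (Y i) = μ := fun i => (hlaw i).map_eq
  have hint : Integrable (fun ω => ψ (Y 0 ω)) P :=
    (integrable_map_measure (f := Y 0) (by rw [hmap]; exact hψi.aestronglyMeasurable)
      (hlaw 0).aemeasurable).1 (by rwa [hmap])
  have hlln := strong_law_ae (μ := P) (fun i ω => ψ (Y i ω)) hint
    (fun i j hij => (hindep.indepFun hij).comp hψ.measurable hψ.measurable)
    (fun i => (IdentDistrib.mk (hlaw i).aemeasurable (hlaw 0).aemeasurable
      ((hmap i).trans (hmap 0).symm)).comp hψ.measurable)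
  have hmean : ∫ ω, ψ (Y 0 ω) ∂P = ∫ x, φ x ∂μ := by
    rw [integral_congr_ae hae, ← hmap 0,
      integral_map (hlaw 0).aemeasurable hψ.aestronglyMeasurable]
  have heq : ∀ᵐ ω ∂P, ∀ i, φ (Y i ω) = ψ (Y i ω) := ae_all_iff.2 fun i =>
    ae_of_ae_map (hlaw i).aemeasurable (by rw [hmap]; exact hae)
  filter_upwards [hlln, heq] with ω hω he
  rw [hmean] at hω
  refine hω.congr fun n => ?_
  simp only [smul_eq_mul, Finset.sum_range, he]

end UniformLaw

/-! ### The law of the data and its finite products. -/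

section DataLaw

/-- The product of finitely many measures with densities. -/
lemma pi_withDensity_ofReal {n : ℕ} {X : Type*} [MeasurableSpace X] {μ : Measure X}
    [SigmaFinite μ] {g : X → ℝ} (hg : Integrable g μ) (h0 : ∀ x, 0 ≤ g x) :
    Measure.pi (fun _ : Fin n => μ.withDensity (fun x => ENNReal.ofReal (g x)))
      = (Measure.pi fun _ : Fin n => μ).withDensity
        (fun x => ENNReal.ofReal (∏ i, g (x i))) := by
  have : IsFiniteMeasure (μ.withDensity (fun x => ENNReal.ofReal (g x))) :=
    isFiniteMeasure_withDensity_ofReal hg.2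
  refine Measure.pi_eq fun s hs => ?_
  have hi : ∀ i, Integrable ((s i).indicator g) μ := fun i => hg.indicator (hs i)
  -- The indicator of a box factorises, so the mass of the box is a product of integrals over single
  -- coordinates.
  have hprod : ∀ x : Fin n → X, (univ.pi s).indicator (fun x => ∏ i, g (x i)) x
      = ∏ i, (s i).indicator g (x i) := by
    intro x
    by_cases hx : x ∈ univ.pi s
    · rw [indicator_of_mem hx]
      exact Finset.prod_congr rfl fun i _ => (indicator_of_mem (hx i (mem_univ i)) _).symm
    · rw [indicator_of_notMem hx]
      obtain ⟨i, hxi⟩ : ∃ i, x i ∉ s i := by simpa [Set.mem_pi] using hx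
      exact (Finset.prod_eq_zero (Finset.mem_univ i) (indicator_of_notMem hxi _)).symm
  have hpos : ∀ i, ∀ x, 0 ≤ (s i).indicator g x := fun i x => indicator_nonneg (fun x _ => h0 x) x
  rw [withDensity_apply _ (MeasurableSet.univ_pi hs),
    ← ofReal_integral_eq_lintegral_ofReal (Integrable.fintype_prod fun _ => hg).integrableOn
      (Eventually.of_forall fun x => Finset.prod_nonneg fun i _ => h0 _),
    ← integral_indicator (MeasurableSet.univ_pi hs)]
  simp_rw [hprod]
  rw [integral_fintype_prod_eq_prod (fun i => (s i).indicator g),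
    ENNReal.ofReal_prod_of_nonneg fun i _ => integral_nonneg (hpos i)]
  refine Finset.prod_congr rfl fun i _ => ?_
  rw [withDensity_apply _ (hs i), integral_indicator (hs i),
    ofReal_integral_eq_lintegral_ofReal hg.integrableOn (Eventually.of_forall h0)]

variable {p d : ℕ} {f : E p → E d → ℝ} {Θ : Set (E p)} {prior : E p → ℝ} {g h : E d → ℝ}
  {Γ : Set ℝ}

/-- The distribution of one observation. -/
def dataLaw (g : E d → ℝ) : Measure (E d) :=
  (volume : Measure (E d)).withDensity (fun y => ENNReal.ofReal (g y))

lemma Regular.integrable_density (hreg : Regular f Θ prior g Γ) : Integrable g := by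
  by_contra hn
  have := hreg.data_integral
  rw [integral_undef hn] at this
  exact zero_ne_one this

lemma Regular.measurable_density (hreg : Regular f Θ prior g Γ) : Measurable g :=
  hreg.data_contDiff.continuous.measurable

lemma Regular.isProbabilityMeasure_data (hreg : Regular f Θ prior g Γ) :
    IsProbabilityMeasure (dataLaw g) := by
  refine ⟨?_⟩
  rw [dataLaw, withDensity_apply _ MeasurableSet.univ, Measure.restrict_univ,
    ← ofReal_integral_eq_lintegral_ofReal hreg.integrable_density
      (Eventually.of_forall hreg.data_nonneg), hreg.data_integral, ENNReal.ofReal_one]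

lemma Regular.integral_data (hreg : Regular f Θ prior g Γ) (φ : E d → ℝ) :
    ∫ y, φ y ∂dataLaw g = ∫ y, φ y * g y := by
  rw [dataLaw, integral_withDensity_eq_integral_toReal_smul
    hreg.measurable_density.ennreal_ofReal (by simp)]
  congr with y
  simp [ENNReal.toReal_ofReal (hreg.data_nonneg y), mul_comm]

lemma Regular.integrable_data_iff (hreg : Regular f Θ prior g Γ) {φ : E d → ℝ} :
    Integrable φ (dataLaw g) ↔ Integrable (fun y => φ y * g y) := by
  rw [dataLaw, integrable_withDensity_iff hreg.measurable_density.ennreal_ofReal (by simp)]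
  refine integrable_congr (Eventually.of_forall fun y => ?_)
  simp [ENNReal.toReal_ofReal (hreg.data_nonneg y)]

lemma Regular.integral_pi_data (hreg : Regular f Θ prior g Γ) {n : ℕ}
    (φ : (Fin n → E d) → ℝ) :
    ∫ y, φ y ∂(Measure.pi fun _ => dataLaw g) = ∫ y, φ y * ∏ i, g (y i) := by
  simp only [dataLaw]
  rw [pi_withDensity_ofReal hreg.integrable_density hreg.data_nonneg,
    integral_withDensity_eq_integral_toReal_smul ?_ (by simp)]
  · rw [← volume_pi]
    congr with y
    simp [ENNReal.toReal_ofReal (Finset.prod_nonneg fun i _ => hreg.data_nonneg (y i)), mul_comm]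
  · exact (Finset.measurable_prod _ fun i _ =>
      hreg.measurable_density.comp (measurable_pi_apply i)).ennreal_ofReal

end DataLaw

/-! ### The target: continuity, separation, prior mass. -/

section ExpectedLogLik

variable {p d : ℕ} {f : E p → E d → ℝ} {Θ K : Set (E p)} {prior : E p → ℝ} {g h u : E d → ℝ}
  {Γ : Set ℝ} {θstar : ℝ → E p} {γ : ℝ}

lemma continuousOn_integral_of_continuousOn {T X : Type*} [TopologicalSpace T]
    [FirstCountableTopology T] [TopologicalSpace X] [SecondCountableTopology X]
    [MeasurableSpace X] [BorelSpace X] {μ : Measure X} {S : Set T} {φ : T → X → ℝ}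
    (hφ : ContinuousOn (fun q : T × X => φ q.1 q.2) (S ×ˢ univ)) {H : X → ℝ}
    (hH : Integrable H μ) (hb : ∀ t ∈ S, ∀ x, |φ t x| ≤ H x) :
    ContinuousOn (fun t => ∫ x, φ t x ∂μ) S := by
  intro t ht
  refine continuousWithinAt_of_dominated (bound := H) ?_ ?_ hH (Eventually.of_forall fun x => ?_)
  · filter_upwards [self_mem_nhdsWithin] with s hs
    exact (hφ.comp_continuous (Continuous.prodMk_right s)
      fun x => ⟨hs, mem_univ _⟩).stronglyMeasurable.aestronglyMeasurable
  · filter_upwards [self_mem_nhdsWithin] with s hs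
    exact Eventually.of_forall (hb s hs)
  · exact hφ.comp (f := fun t : T => (t, x)) (by fun_prop) (fun s hs => ⟨hs, mem_univ _⟩) t ht

/-- The expected log pseudo-likelihood under the data. -/
def expLogLik (f : E p → E d → ℝ) (g : E d → ℝ) (q : ℝ × E p) : ℝ :=
  ∫ y, logLik f q.1 y q.2 ∂dataLaw g

/-- Joint continuity in the form `((γ, θ), y)`. -/
lemma continuousOn_assoc {φ : ℝ → E d → E p → ℝ}
    (hφ : ContinuousOn (fun q : ℝ × E p × E d => φ q.1 q.2.2 q.2.1) (Γ ×ˢ Θ ×ˢ univ)) :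
    ContinuousOn (fun q : (ℝ × E p) × E d => φ q.1.1 q.2 q.1.2) ((Γ ×ˢ Θ) ×ˢ univ) :=
  hφ.comp (f := fun q : (ℝ × E p) × E d => (q.1.1, q.1.2, q.2)) (by fun_prop)
    fun _ hq => ⟨hq.1.1, hq.1.2, mem_univ _⟩

lemma Regular.continuousOn_expLogLik (hreg : Regular f Θ prior g Γ) :
    ContinuousOn (expLogLik f g) (Γ ×ˢ Θ) := by
  obtain ⟨h, henv, hi⟩ := hreg.exists_isEnvelope
  exact continuousOn_integral_of_continuousOn (T := ℝ × E p)
    (φ := fun q y => logLik f q.1 y q.2) (continuousOn_assoc hreg.continuousOn_logLik)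
    (hreg.integrable_data_iff.2 hi) fun q hq => henv.abs_logLik_le _ hq.1 _ hq.2

lemma Regular.integrable_logLik (hreg : Regular f Θ prior g Γ) (hγ : γ ∈ Γ) {θ : E p}
    (hθ : θ ∈ Θ) : Integrable (fun y => logLik f γ y θ) (dataLaw g) := by
  obtain ⟨h, henv, hi⟩ := hreg.exists_isEnvelope
  exact (hreg.integrable_data_iff.2 hi).mono'
    (hreg.contDiff_logLik γ hθ).continuous.stronglyMeasurable.aestronglyMeasurable
    (Eventually.of_forall (henv.abs_logLik_le γ hγ θ hθ))

lemma Identified.expLogLik_lt (hreg : Regular f Θ prior g Γ)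
    (hid : Identified f Θ prior g Γ θstar) (hγ : γ ∈ Γ) {θ : E p} (hθ : θ ∈ Θ)
    (hne : θ ≠ θstar γ) : expLogLik f g (γ, θ) < expLogLik f g (γ, θstar γ) := by
  simp only [expLogLik, hreg.integral_data]
  exact hid.unique_max γ hγ θ hθ hne

lemma Identified.expLogLik_le (hreg : Regular f Θ prior g Γ)
    (hid : Identified f Θ prior g Γ θstar) (hγ : γ ∈ Γ) {θ : E p} (hθ : θ ∈ Θ) :
    expLogLik f g (γ, θ) ≤ expLogLik f g (γ, θstar γ) := by
  rcases eq_or_ne θ (θstar γ) with rfl | hne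
  · exact le_rfl
  · exact (hid.expLogLik_lt hreg hγ hθ hne).le

/-- `K` is a compact set of parameters outside of which the pseudo-likelihood is uniformly worse
than at the target, as witnessed by `u`. -/
structure TailBound (f : E p → E d → ℝ) (Θ : Set (E p)) (g : E d → ℝ) (Γ : Set ℝ)
    (θstar : ℝ → E p) (K : Set (E p)) (u : E d → ℝ) : Prop where
  isCompact : IsCompact K
  subset : K ⊆ Θ
  integrable : Integrable u (dataLaw g)
  integral_neg : ∫ y, u y ∂dataLaw g < 0
  logLik_le : ∀ γ ∈ Γ, ∀ θ ∈ Θ, θ ∉ K → ∀ y, logLik f γ y θ - logLik f γ y (θstar γ) ≤ u y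

lemma Identified.exists_tailBound (hreg : Regular f Θ prior g Γ)
    (hid : Identified f Θ prior g Γ θstar) : ∃ K u, TailBound f Θ g Γ θstar K u := by
  obtain ⟨K, u, h1, h2, h3, h4, h5⟩ := hid.tail
  exact ⟨K, u, h1, h2, hreg.integrable_data_iff.2 h3, by rwa [hreg.integral_data], h5⟩

/-- Outside `K` the tail bound applied to the target itself would read 0 ≤ `u`, against the negative
integral of `u`. -/
lemma TailBound.star_mem (ht : TailBound f Θ g Γ θstar K u)
    (hid : Identified f Θ prior g Γ θstar) (hγ : γ ∈ Γ) : θstar γ ∈ K := by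
  by_contra hn
  refine absurd ht.integral_neg (not_lt.2 (integral_nonneg fun y => ?_))
  simpa using ht.logLik_le γ hγ _ (hid.mem γ hγ) hn y

/-- The target depends continuously on the tuning parameter. -/
theorem Identified.continuousOn_star (hreg : Regular f Θ prior g Γ)
    (hid : Identified f Θ prior g Γ θstar) : ContinuousOn θstar Γ := by
  obtain ⟨K, u, ht⟩ := hid.exists_tailBound hreg
  intro γ hγ
  -- The target stays in the compact `K`, so it suffices that its only cluster point at `γ` is
  -- `θstar γ`.
  refine ht.isCompact.tendsto_nhds_of_unique_mapClusterPt
    (eventually_mem_nhdsWithin.mono fun s hs => ht.star_mem hid hs) fun x hx hcl => ?_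
  by_contra hne
  have hlt := hid.expLogLik_lt hreg hγ (ht.subset hx) hne
  -- The level `c` separates M near (γ, x) from M(s, `θstar γ`) for s near γ. A target `θstar s`
  -- close to `x` would thus be beaten by `θstar γ`, contradicting maximality at s.
  obtain ⟨c, hc1, hc2⟩ := exists_between hlt
  have h1 : ∀ᶠ q in 𝓝[Γ ×ˢ Θ] (γ, x), expLogLik f g q < c :=
    (hreg.continuousOn_expLogLik (γ, x) ⟨hγ, ht.subset hx⟩).eventually_lt_const hc1
  have h2 : ∀ᶠ s in 𝓝[Γ] γ, c < expLogLik f g (s, θstar γ) :=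
    (hreg.continuousOn_expLogLik.comp (f := fun s : ℝ => (s, θstar γ)) (by fun_prop)
      (fun s hs => ⟨hs, hid.mem γ hγ⟩) γ hγ).eventually_const_lt hc2
  rw [nhdsWithin_prod_eq] at h1
  obtain ⟨pa, hpa, pb, hpb, hab⟩ := eventually_prod_iff.1 h1
  have hpb' : ∀ᶠ z in 𝓝 x, z ∈ Θ → pb z := eventually_nhdsWithin_iff.1 hpb
  have hfreq := (mapClusterPt_iff_frequently.1 hcl) _ hpb'
  obtain ⟨s, hs, hs1, hs2, hs3⟩ := (hfreq.and_eventually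
    (hpa.and (h2.and eventually_mem_nhdsWithin))).exists
  have h3 := hab hs1 (hs (hid.mem s hs3))
  exact absurd (hid.expLogLik_le hreg hs3 (hid.mem γ hγ)) (not_le.2 (h3.trans hs2))

/-- The target is well separated, uniformly in the tuning parameter. -/
lemma TailBound.exists_gap (ht : TailBound f Θ g Γ θstar K u) (hreg : Regular f Θ prior g Γ)
    (hid : Identified f Θ prior g Γ θstar) {δ : ℝ} (hδ : 0 < δ) :
    ∃ η > 0, ∀ γ ∈ Γ, ∀ θ ∈ K, δ ≤ dist θ (θstar γ) →
      expLogLik f g (γ, θ) + η ≤ expLogLik f g (γ, θstar γ) := by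
  have hΓK : IsCompact (Γ ×ˢ K) := hreg.isCompact_tuning.prod ht.isCompact
  have hst : ContinuousOn (fun q : ℝ × E p => θstar q.1) (Γ ×ˢ K) :=
    (hid.continuousOn_star hreg).comp continuousOn_fst fun q hq => hq.1
  -- Continuity of the target makes `A` compact, and the gap is the minimum over it of a positive
  -- continuous function.
  set A := (Γ ×ˢ K) ∩ (fun q : ℝ × E p => dist q.2 (θstar q.1)) ⁻¹' Ici δ with hA
  have hAc : IsCompact A := hΓK.of_isClosed_subset
    ((continuous_dist.comp_continuousOn
      (continuousOn_snd.prodMk hst)).preimage_isClosed_of_isClosed hΓK.isClosed isClosed_Ici)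
    inter_subset_left
  have hM : ContinuousOn (fun q : ℝ × E p => expLogLik f g (q.1, θstar q.1) - expLogLik f g q)
      A := by
    refine ContinuousOn.sub ?_ ?_
    · exact hreg.continuousOn_expLogLik.comp (continuousOn_fst.prodMk (hst.mono inter_subset_left))
        fun q hq => ⟨hq.1.1, hid.mem _ hq.1.1⟩
    · exact hreg.continuousOn_expLogLik.mono fun q hq => ⟨hq.1.1, ht.subset hq.1.2⟩
  rcases A.eq_empty_or_nonempty with he | hne
  · refine ⟨1, one_pos, fun γ hγ θ hθ hd => ?_⟩
    have : (γ, θ) ∈ A := ⟨⟨hγ, hθ⟩, hd⟩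
    rw [he] at this
    exact this.elim
  · obtain ⟨q, hq, hmin⟩ := hAc.exists_isMinOn hne hM
    refine ⟨expLogLik f g (q.1, θstar q.1) - expLogLik f g q, ?_, fun γ hγ θ hθ hd => ?_⟩
    · refine sub_pos.2 (hid.expLogLik_lt hreg hq.1.1 (ht.subset hq.1.2) fun h => ?_)
      have : δ ≤ dist q.2 (θstar q.1) := hq.2
      rw [h, dist_self] at this
      linarith
    · have := hmin (show (γ, θ) ∈ A from ⟨⟨hγ, hθ⟩, hd⟩)
      simp only [Set.mem_ofPred_eq] at this
      linarith

/-- Parameters in `Θ` close to the target belong to `K`, uniformly in the tuning parameter. -/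
lemma TailBound.exists_ball_subset (ht : TailBound f Θ g Γ θstar K u)
    (hreg : Regular f Θ prior g Γ) (hid : Identified f Θ prior g Γ θstar) :
    ∃ r > 0, ∀ γ ∈ Γ, Θ ∩ Metric.ball (θstar γ) r ⊆ K := by
  refine hreg.isCompact_tuning.induction_on
    (p := fun s => ∃ r > 0, ∀ γ ∈ s, Θ ∩ Metric.ball (θstar γ) r ⊆ K)
    ⟨1, one_pos, by simp⟩ ?_ ?_ ?_
  · rintro s t hst ⟨r, hr, hb⟩
    exact ⟨r, hr, fun γ hγ => hb γ (hst hγ)⟩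
  · rintro s t ⟨r, hr, hb⟩ ⟨r', hr', hb'⟩
    refine ⟨min r r', lt_min hr hr', fun γ hγ => ?_⟩
    rcases hγ with hγ | hγ
    · exact (inter_subset_inter_right _ (Metric.ball_subset_ball (min_le_left _ _))).trans
        (hb γ hγ)
    · exact (inter_subset_inter_right _ (Metric.ball_subset_ball (min_le_right _ _))).trans
        (hb' γ hγ)
  · intro γ hγ
    -- Off `K` the tail bound keeps M at most M(γ, `θstar γ`) + ∫ u. Since ∫ u is negative,
    -- continuity puts M above this level near the target, so nearby points of `Θ` lie in `K`.
    have h1 : ∀ᶠ θ in 𝓝[Θ] (θstar γ),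
        expLogLik f g (γ, θstar γ) + ∫ y, u y ∂dataLaw g < expLogLik f g (γ, θ) :=
      (hreg.continuousOn_expLogLik.comp (f := fun θ : E p => (γ, θ)) (by fun_prop)
        (fun θ hθ => ⟨hγ, hθ⟩) _ (hid.mem γ hγ)).eventually_const_lt
        (by have := ht.integral_neg; simp only [Function.comp]; linarith)
    obtain ⟨r, hr, hb⟩ := Metric.mem_nhdsWithin_iff.1 h1
    have hsub : Metric.ball (θstar γ) r ∩ Θ ⊆ K := by
      intro θ hθ
      by_contra hn
      have h2 := hb hθ
      simp only [Set.mem_ofPred_eq] at h2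
      have h3 : ∫ y, (logLik f γ y θ - logLik f γ y (θstar γ)) ∂dataLaw g
          ≤ ∫ y, u y ∂dataLaw g :=
        integral_mono ((hreg.integrable_logLik hγ hθ.2).sub
          (hreg.integrable_logLik hγ (hid.mem γ hγ))) ht.integrable
          (ht.logLik_le γ hγ θ hθ.2 hn)
      rw [integral_sub (hreg.integrable_logLik hγ hθ.2)
        (hreg.integrable_logLik hγ (hid.mem γ hγ))] at h3
      simp only [expLogLik] at h2
      linarith
    have h4 : ∀ᶠ s in 𝓝[Γ] γ, dist (θstar s) (θstar γ) < r / 2 :=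
      hid.continuousOn_star hreg γ hγ (Metric.ball_mem_nhds _ (half_pos hr))
    -- Half of the radius absorbs the displacement of the target as the tuning parameter varies.
    refine ⟨_, h4, r / 2, half_pos hr, fun s hs θ hθ => hsub ⟨?_, hθ.1⟩⟩
    have := dist_triangle θ (θstar s) (θstar γ)
    have h5 : dist θ (θstar s) < r / 2 := hθ.2
    have h6 : dist (θstar s) (θstar γ) < r / 2 := hs
    exact Metric.mem_ball.2 (by linarith)

lemma Identified.prior_ball_pos (hreg : Regular f Θ prior g Γ)
    (hid : Identified f Θ prior g Γ θstar) (hγ : γ ∈ Γ) {ε : ℝ} (hε : 0 < ε) :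
    0 < (priorMeasure Θ prior).real (Θ ∩ Metric.ball (θstar γ) ε) := by
  have h1 := hid.prior_pos γ hγ ε hε
  have hm : MeasurableSet (Θ ∩ Metric.ball (θstar γ) ε) :=
    hreg.measurableSet_param.inter measurableSet_ball
  have h2 := hreg.integral_prior ((Θ ∩ Metric.ball (θstar γ) ε).indicator 1)
  rw [integral_indicator_one hm] at h2
  rw [h2]
  refine h1.trans_eq ?_
  rw [show (fun θ => (Θ ∩ Metric.ball (θstar γ) ε).indicator (1 : E p → ℝ) θ * prior θ)
      = (Θ ∩ Metric.ball (θstar γ) ε).indicator prior from ?_, setIntegral_indicator hm,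
    ← inter_assoc, inter_self]
  funext θ
  by_cases hθ : θ ∈ Θ ∩ Metric.ball (θstar γ) ε <;> simp [hθ]

/-- The prior mass near the target is bounded below, uniformly in the tuning parameter. -/
lemma TailBound.exists_prior_mass (ht : TailBound f Θ g Γ θstar K u)
    (hreg : Regular f Θ prior g Γ) (hid : Identified f Θ prior g Γ θstar) {ε : ℝ}
    (hε : 0 < ε) :
    ∃ m > 0, ∀ γ ∈ Γ, m ≤ (priorMeasure Θ prior).real (K ∩ Metric.ball (θstar γ) ε) := by
  have := hreg.isProbabilityMeasure_prior
  obtain ⟨r, hr, hrK⟩ := ht.exists_ball_subset hreg hid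
  refine hreg.isCompact_tuning.induction_on
    (p := fun s => ∃ m > 0, ∀ γ ∈ s,
      m ≤ (priorMeasure Θ prior).real (K ∩ Metric.ball (θstar γ) ε))
    ⟨1, one_pos, by simp⟩ ?_ ?_ ?_
  · rintro s t hst ⟨m, hm, hb⟩
    exact ⟨m, hm, fun γ hγ => hb γ (hst hγ)⟩
  · rintro s t ⟨m, hm, hb⟩ ⟨m', hm', hb'⟩
    refine ⟨min m m', lt_min hm hm', fun γ hγ => ?_⟩
    rcases hγ with hγ | hγ
    · exact (min_le_left _ _).trans (hb γ hγ)
    · exact (min_le_right _ _).trans (hb' γ hγ)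
  · intro γ hγ
    have h4 : ∀ᶠ s in 𝓝[Γ] γ, dist (θstar s) (θstar γ) < ε / 2 :=
      hid.continuousOn_star hreg γ hγ (Metric.ball_mem_nhds _ (half_pos hε))
    -- The ball around `θstar γ` of radius `min r (ε / 2)` meets `Θ` inside `K` and lies in the
    -- `ε`-ball around every nearby target, so its prior mass serves as a local lower bound.
    refine ⟨_, h4, _, hid.prior_ball_pos hreg hγ (lt_min hr (half_pos hε)), fun s hs => ?_⟩
    refine measureReal_mono fun θ hθ => ⟨hrK γ hγ ⟨hθ.1,
      Metric.ball_subset_ball (min_le_left _ _) hθ.2⟩, ?_⟩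
    have h5 : dist θ (θstar γ) < ε / 2 :=
      Metric.ball_subset_ball (min_le_right _ _) hθ.2
    have h6 : dist (θstar s) (θstar γ) < ε / 2 := hs
    have := dist_triangle_right θ (θstar s) (θstar γ)
    exact Metric.mem_ball.2 (by linarith)

end ExpectedLogLik

/-! ### Uniform posterior concentration. -/

section Concentration

variable {p d : ℕ} {f : E p → E d → ℝ} {Θ K : Set (E p)} {prior : E p → ℝ} {g h u : E d → ℝ}
  {Γ : Set ℝ} {θstar : ℝ → E p} {γ : ℝ} {y : ℕ → E d}

/-- The posterior concentrates at the target, uniformly in the tuning parameter. -/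
def Concentrates (f : E p → E d → ℝ) (Θ : Set (E p)) (prior : E p → ℝ) (Γ : Set ℝ)
    (θstar : ℝ → E p) (y : ℕ → E d) : Prop :=
  ∀ δ > 0, Tendsto (fun q : ℕ × ℝ => (postMeasure f Θ prior q.2 (fun i : Fin q.1 => y i)).real
    {θ | δ ≤ dist θ (θstar q.2)}) (atTop ×ˢ 𝓟 Γ) (𝓝 0)

/-- The posterior mass of the far region is a quotient. The evidence is at least the prior mass `m`
near the target times the likelihood there, while the far likelihood is exponentially smaller: by
the gap of M inside `K`, and by the average of `u` outside. All constants are free of γ. -/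
theorem TailBound.concentrates (ht : TailBound f Θ g Γ θstar K u)
    (hreg : Regular f Θ prior g Γ) (hid : Identified f Θ prior g Γ θstar)
    (hL : TendstoUniformlyOn (fun (n : ℕ) (q : ℝ × E p) =>
      (n : ℝ)⁻¹ * ∑ i : Fin n, logLik f q.1 (y i) q.2) (expLogLik f g) atTop (Γ ×ˢ K))
    (hu : Tendsto (fun n : ℕ => (n : ℝ)⁻¹ * ∑ i : Fin n, u (y i)) atTop
      (𝓝 (∫ x, u x ∂dataLaw g))) :
    Concentrates f Θ prior Γ θstar y := by
  intro δ hδ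
  have := hreg.isProbabilityMeasure_prior
  obtain ⟨η, hη, hgap⟩ := ht.exists_gap hreg hid hδ
  set c := -∫ x, u x ∂dataLaw g with hc
  have hc0 : 0 < c := neg_pos.2 ht.integral_neg
  -- The budget in units of κn, relative to the sum at the target: near it at most 3 is lost (two
  -- sampling errors and one modulus of continuity). Far from it at least 6 is lost: 8 - 2 inside
  -- `K`, and 8 - 1 outside. The quotient thus decays like exp(-3κn) / m.
  set κ := min η c / 8 with hκ
  have hκ0 : 0 < κ := by have := lt_min hη hc0; positivity
  have hκη : 8 * κ ≤ η := by have := min_le_left η c; linarith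
  have hκc : 8 * κ ≤ c := by have := min_le_right η c; linarith
  have hΓK : IsCompact (Γ ×ˢ K) := hreg.isCompact_tuning.prod ht.isCompact
  obtain ⟨ε, hε, hunif⟩ := Metric.uniformContinuousOn_iff.1
    (hΓK.uniformContinuousOn_of_continuous (hreg.continuousOn_expLogLik.mono
      (prod_mono_right ht.subset))) κ hκ0
  obtain ⟨m, hm, hmass⟩ := ht.exists_prior_mass hreg hid hε
  have hlim : Tendsto (fun q : ℕ × ℝ => exp (-(3 * κ * q.1)) / m) (atTop ×ˢ 𝓟 Γ) (𝓝 0) := by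
    have h1 : Tendsto (fun n : ℕ => exp (-(3 * κ * n)) / m) atTop (𝓝 (0 / m)) :=
      (tendsto_exp_neg_atTop_nhds_zero.comp
        (tendsto_natCast_atTop_atTop.const_mul_atTop (by positivity))).div_const m
    rw [zero_div] at h1
    exact h1.comp tendsto_fst
  refine squeeze_zero' (Eventually.of_forall fun q => measureReal_nonneg) ?_ hlim
  have hev : ∀ᶠ n : ℕ in atTop, (1 ≤ n ∧ (n : ℝ)⁻¹ * ∑ i : Fin n, u (y i) < -c + κ) ∧
      ∀ q ∈ Γ ×ˢ K, dist (expLogLik f g q)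
        ((n : ℝ)⁻¹ * ∑ i : Fin n, logLik f q.1 (y i) q.2) < κ :=
    ((eventually_ge_atTop 1).and (hu.eventually_lt_const (by linarith))).and
      (Metric.tendstoUniformlyOn_iff.1 hL κ hκ0)
  rw [eventually_prod_principal_iff]
  filter_upwards [hev] with n hn γ hγ
  obtain ⟨⟨hn1, hnu⟩, hnL⟩ := hn
  have hn0 : (0 : ℝ) < n := by exact_mod_cast hn1
  set S : E p → ℝ := fun θ => ∑ i : Fin n, logLik f γ (y i) θ with hS
  have hstarK := ht.star_mem hid hγ
  have hsum : ∀ θ ∈ K, |S θ - n * expLogLik f g (γ, θ)| ≤ n * κ := by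
    intro θ hθ
    have h1 := (hnL (γ, θ) ⟨hγ, hθ⟩).le
    rw [dist_comm, Real.dist_eq] at h1
    calc |S θ - n * expLogLik f g (γ, θ)|
        = |n * ((n : ℝ)⁻¹ * S θ - expLogLik f g (γ, θ))| := by
          congr 1; field_simp
      _ = n * |(n : ℝ)⁻¹ * S θ - expLogLik f g (γ, θ)| := by
          rw [abs_mul, abs_of_pos hn0]
      _ ≤ n * κ := by gcongr
  have hSstar := abs_le.1 (hsum _ hstarK)
  have hnear : ∀ θ ∈ K ∩ Metric.ball (θstar γ) ε, S (θstar γ) - 3 * κ * n ≤ S θ := by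
    intro θ hθ
    have h1 := abs_le.1 (hsum θ hθ.1)
    have h2 := hunif (γ, θ) ⟨hγ, hθ.1⟩ (γ, θstar γ) ⟨hγ, hstarK⟩
      (by simpa [Prod.dist_eq] using hθ.2)
    rw [Real.dist_eq] at h2
    have h3 := (abs_lt.1 h2).1
    nlinarith
  have hfar : ∀ θ ∈ Θ, δ ≤ dist θ (θstar γ) → S θ ≤ S (θstar γ) - 6 * κ * n := by
    intro θ hθ hd
    by_cases hK : θ ∈ K
    · have h1 := abs_le.1 (hsum θ hK)
      have h2 := hgap γ hγ θ hK hd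
      nlinarith
    · have h1 : S θ - S (θstar γ) ≤ ∑ i : Fin n, u (y i) := by
        rw [hS, ← Finset.sum_sub_distrib]
        exact Finset.sum_le_sum fun i _ => ht.logLik_le γ hγ θ hθ hK (y i)
      have h2 : ∑ i : Fin n, u (y i) ≤ n * (-c + κ) := by
        have := mul_le_mul_of_nonneg_left hnu.le hn0.le
        rwa [← mul_assoc, mul_inv_cancel₀ hn0.ne', one_mul] at this
      nlinarith
  have hint := hreg.integrable_lik hγ (fun i : Fin n => y i)
  have hfm : MeasurableSet {θ : E p | δ ≤ dist θ (θstar γ)} :=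
    (isClosed_le continuous_const (by fun_prop)).measurableSet
  have hden : m * exp (S (θstar γ) - 3 * κ * n)
      ≤ ∫ θ, exp (S θ) ∂priorMeasure Θ prior := by
    have hAm : MeasurableSet (K ∩ Metric.ball (θstar γ) ε) :=
      ht.isCompact.isClosed.measurableSet.inter measurableSet_ball
    calc m * exp (S (θstar γ) - 3 * κ * n)
        ≤ (priorMeasure Θ prior).real (K ∩ Metric.ball (θstar γ) ε)
          * exp (S (θstar γ) - 3 * κ * n) := by gcongr; exact hmass γ hγ
      _ = ∫ θ, (K ∩ Metric.ball (θstar γ) ε).indicator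
            (fun _ => exp (S (θstar γ) - 3 * κ * n)) θ ∂priorMeasure Θ prior := by
          rw [integral_indicator_const _ hAm, smul_eq_mul]
      _ ≤ ∫ θ, exp (S θ) ∂priorMeasure Θ prior := by
          refine integral_mono ((integrable_const _).indicator hAm) hint fun θ => ?_
          by_cases hθ : θ ∈ K ∩ Metric.ball (θstar γ) ε
          · rw [indicator_of_mem hθ]
            exact exp_le_exp.2 (hnear θ hθ)
          · rw [indicator_of_notMem hθ]
            exact (exp_pos _).le
  have hnum : ∫ θ, {θ : E p | δ ≤ dist θ (θstar γ)}.indicator 1 θ * exp (S θ)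
      ∂priorMeasure Θ prior ≤ exp (S (θstar γ) - 6 * κ * n) := by
    have h1 : ∀ᵐ θ ∂priorMeasure Θ prior,
        {θ : E p | δ ≤ dist θ (θstar γ)}.indicator 1 θ * exp (S θ)
          ≤ exp (S (θstar γ) - 6 * κ * n) := by
      filter_upwards [hreg.ae_mem] with θ hθ
      by_cases hd : θ ∈ {θ : E p | δ ≤ dist θ (θstar γ)}
      · rw [indicator_of_mem hd, Pi.one_apply, one_mul]
        exact exp_le_exp.2 (hfar θ hθ hd)
      · rw [indicator_of_notMem hd, zero_mul]
        exact (exp_pos _).le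
    have h2 := integral_mono_of_nonneg (μ := priorMeasure Θ prior)
      (f := fun θ => {θ : E p | δ ≤ dist θ (θstar γ)}.indicator 1 θ * exp (S θ))
      (Eventually.of_forall fun θ =>
        mul_nonneg (indicator_nonneg (fun _ _ => zero_le_one) θ) (exp_pos (S θ)).le)
      (integrable_const _) h1
    simpa using h2
  have h0 : 0 < m * exp (S (θstar γ) - 3 * κ * n) := by positivity
  calc (postMeasure f Θ prior γ (fun i : Fin n => y i)).real {θ | δ ≤ dist θ (θstar γ)}
      = (∫ θ, {θ : E p | δ ≤ dist θ (θstar γ)}.indicator 1 θ * exp (S θ)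
          ∂priorMeasure Θ prior) / ∫ θ, exp (S θ) ∂priorMeasure Θ prior := by
        rw [← integral_indicator_one hfm, integral_post]
    _ ≤ exp (S (θstar γ) - 6 * κ * n) / (m * exp (S (θstar γ) - 3 * κ * n)) :=
        div_le_div₀ (exp_pos _).le hnum h0 hden
    _ = exp (-(3 * κ * n)) / m := by
        rw [show S (θstar γ) - 6 * κ * n = (S (θstar γ) - 3 * κ * n) + -(3 * κ * n) by ring,
          exp_add]
        field_simp

/-- Posterior expectations of functions that are small near the target vanish asymptotically. -/
lemma Concentrates.tendsto_integral (hconc : Concentrates f Θ prior Γ θstar y)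
    (hreg : Regular f Θ prior g Γ) {b : ℕ → ℝ → E p → ℝ} {C : ℝ}
    (h0 : ∀ n, ∀ γ ∈ Γ, ∀ θ ∈ Θ, 0 ≤ b n γ θ)
    (hC : ∀ᶠ n in atTop, ∀ γ ∈ Γ, ∀ θ ∈ Θ, b n γ θ ≤ C)
    (hnear : ∀ ε > 0, ∃ δ > 0, ∀ᶠ n in atTop, ∀ γ ∈ Γ, ∀ θ ∈ Θ,
      dist θ (θstar γ) < δ → b n γ θ ≤ ε) :
    Tendsto (fun q : ℕ × ℝ => ∫ θ, b q.1 q.2 θ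
      ∂postMeasure f Θ prior q.2 (fun i : Fin q.1 => y i)) (atTop ×ˢ 𝓟 Γ) (𝓝 0) := by
  rw [Metric.tendsto_nhds]
  intro ε hε
  -- The integral is split at distance `δ`: the near part contributes at most `ε / 2`, the far part
  -- at most its vanishing mass times a constant.
  obtain ⟨δ, hδ, hn⟩ := hnear (ε / 2) (half_pos hε)
  have h1 := ((hconc δ hδ).const_mul (max C 0)).eventually_lt_const
    (show max C 0 * 0 < ε / 2 by rw [mul_zero]; exact half_pos hε)
  rw [eventually_prod_principal_iff] at h1 ⊢
  filter_upwards [h1, hn, hC] with n h1 hn hC γ hγ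
  have := hreg.isProbabilityMeasure_post hγ (fun i : Fin n => y i)
  set Q := postMeasure f Θ prior γ (fun i : Fin n => y i) with hQ
  have hfm : MeasurableSet {θ : E p | δ ≤ dist θ (θstar γ)} :=
    (isClosed_le continuous_const (by fun_prop)).measurableSet
  have hmem : ∀ᵐ θ ∂Q, θ ∈ Θ := hreg.ae_mem_post
  have hle : ∀ᵐ θ ∂Q, b n γ θ
      ≤ ε / 2 + {θ : E p | δ ≤ dist θ (θstar γ)}.indicator (fun _ => max C 0) θ := by
    filter_upwards [hmem] with θ hθ
    by_cases hd : θ ∈ {θ : E p | δ ≤ dist θ (θstar γ)}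
    · rw [indicator_of_mem hd]
      have := (hC γ hγ θ hθ).trans (le_max_left C 0)
      linarith
    · rw [indicator_of_notMem hd, add_zero]
      exact hn γ hγ θ hθ (not_le.1 hd)
  have h2 : ∫ θ, b n γ θ ∂Q ≤ ε / 2 + max C 0 * Q.real {θ | δ ≤ dist θ (θstar γ)} := by
    refine (integral_mono_of_nonneg (hmem.mono fun θ hθ => h0 n γ hγ θ hθ)
      ((integrable_const _).add ((integrable_const _).indicator hfm)) hle).trans_eq ?_
    rw [integral_add' (integrable_const _) ((integrable_const _).indicator hfm),
      integral_indicator_const _ hfm]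
    simp [mul_comm]
  rw [Real.dist_eq, sub_zero, abs_of_nonneg
    (integral_nonneg_of_ae (hmem.mono fun θ hθ => h0 n γ hγ θ hθ))]
  have h3 := h1 γ hγ
  linarith

end Concentration

/-! ### Posterior expectations compared with values at the target. -/

section Discrepancy

variable {p d : ℕ} {f : E p → E d → ℝ} {Θ K : Set (E p)} {prior : E p → ℝ} {g h u : E d → ℝ}
  {Γ : Set ℝ} {θstar : ℝ → E p} {γ : ℝ} {y : ℕ → E d}

/-- A continuous function of the parameters that vanishes at the target is uniformly small near
the target. -/
lemma TailBound.exists_near (ht : TailBound f Θ g Γ θstar K u) (hreg : Regular f Θ prior g Γ)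
    (hid : Identified f Θ prior g Γ θstar) {φ : ℝ × E p → ℝ} (hφ : ContinuousOn φ (Γ ×ˢ K))
    (h0 : ∀ γ ∈ Γ, φ (γ, θstar γ) = 0) {ε : ℝ} (hε : 0 < ε) :
    ∃ δ > 0, ∀ γ ∈ Γ, ∀ θ ∈ Θ, dist θ (θstar γ) < δ → θ ∈ K ∧ φ (γ, θ) ≤ ε := by
  obtain ⟨r, hr, hrK⟩ := ht.exists_ball_subset hreg hid
  obtain ⟨δ, hδ, hunif⟩ := Metric.uniformContinuousOn_iff.1
    ((hreg.isCompact_tuning.prod ht.isCompact).uniformContinuousOn_of_continuous hφ) ε hε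
  refine ⟨min r δ, lt_min hr hδ, fun γ hγ θ hθ hd => ?_⟩
  have hK : θ ∈ K := hrK γ hγ ⟨hθ, hd.trans_le (min_le_left _ _)⟩
  have h1 := hunif (γ, θ) ⟨hγ, hK⟩ (γ, θstar γ) ⟨hγ, ht.star_mem hid hγ⟩
    (by simpa [Prod.dist_eq] using hd.trans_le (min_le_right _ _))
  rw [h0 γ hγ, Real.dist_eq, sub_zero] at h1
  exact ⟨hK, ((le_abs_self _).trans_lt h1).le⟩

/-- Composition of a jointly continuous function of `((γ, θ), y)` with the target. -/
lemma Identified.continuousOn_comp_star (hreg : Regular f Θ prior g Γ)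
    (hid : Identified f Θ prior g Γ θstar) {φ : ℝ → E d → E p → ℝ}
    (hφ : ContinuousOn (fun q : ℝ × E p × E d => φ q.1 q.2.2 q.2.1) (Γ ×ˢ Θ ×ˢ univ)) :
    ContinuousOn (fun q : ℝ × E d => φ q.1 q.2 (θstar q.1)) (Γ ×ˢ univ) := by
  have hst : ContinuousOn (fun q : ℝ × E d => θstar q.1) (Γ ×ˢ univ) :=
    (hid.continuousOn_star hreg).comp continuousOn_fst fun q hq => hq.1
  exact hφ.comp (f := fun q : ℝ × E d => (q.1, θstar q.1, q.2))
    (continuousOn_fst.prodMk (hst.prodMk continuousOn_snd))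
    fun q hq => ⟨hq.1, hid.mem _ hq.1, mem_univ _⟩

/-- Joint continuity of the absolute difference to the value at the target. -/
lemma Identified.continuousOn_sub_star (hreg : Regular f Θ prior g Γ)
    (hid : Identified f Θ prior g Γ θstar) {φ : ℝ → E d → E p → ℝ}
    (hφ : ContinuousOn (fun q : ℝ × E p × E d => φ q.1 q.2.2 q.2.1) (Γ ×ˢ Θ ×ˢ univ)) :
    ContinuousOn (fun q : (ℝ × E p) × E d => |φ q.1.1 q.2 q.1.2 - φ q.1.1 q.2 (θstar q.1.1)|)
      ((Γ ×ˢ Θ) ×ˢ univ) :=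
  ((continuousOn_assoc hφ).sub ((hid.continuousOn_comp_star hreg hφ).comp
    (f := fun q : (ℝ × E p) × E d => (q.1.1, q.2)) (by fun_prop)
    fun _ hq => ⟨hq.1.1, mem_univ _⟩)).abs

lemma Regular.integrable_score_post (hreg : Regular f Θ prior g Γ) (hγ : γ ∈ Γ)
    {ι : Type} [Fintype ι] (x : ι → E d) (z : E d) (k : Fin d) :
    Integrable (fun θ => score f k γ z θ) (postMeasure f Θ prior γ x) := by
  have := hreg.isProbabilityMeasure_post hγ x
  obtain ⟨h, henv, -⟩ := hreg.exists_isEnvelope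
  exact hreg.integrable_param postMeasure_absolutelyContinuous
    (hreg.continuousOn_score_param hγ z k) fun θ hθ => henv.abs_score_le hγ hθ z k

/-- A posterior expectation is bounded by any bound on `Θ`. -/
lemma Regular.abs_integral_post_le (hreg : Regular f Θ prior g Γ) (hγ : γ ∈ Γ)
    {ι : Type} [Fintype ι] (x : ι → E d) {φ : E p → ℝ} {C : ℝ} (hb : ∀ θ ∈ Θ, |φ θ| ≤ C) :
    |∫ θ, φ θ ∂postMeasure f Θ prior γ x| ≤ C := by
  have := hreg.isProbabilityMeasure_post hγ x
  have h1 := norm_integral_le_of_norm_le_const (μ := postMeasure f Θ prior γ x) (f := φ) (C := C)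
    (hreg.ae_mem_post.mono fun θ hθ => hb θ hθ)
  simpa using h1

/-- The distance of a posterior expectation to a constant. -/
lemma Regular.abs_integral_post_sub_le (hreg : Regular f Θ prior g Γ) (hγ : γ ∈ Γ)
    {ι : Type} [Fintype ι] (x : ι → E d) {φ : E p → ℝ}
    (hφ : Integrable φ (postMeasure f Θ prior γ x)) (c : ℝ) :
    |∫ θ, φ θ ∂postMeasure f Θ prior γ x - c| ≤ ∫ θ, |φ θ - c| ∂postMeasure f Θ prior γ x := by
  have := hreg.isProbabilityMeasure_post hγ x
  have h1 : ∫ θ, (φ θ - c) ∂postMeasure f Θ prior γ x = ∫ θ, φ θ ∂postMeasure f Θ prior γ x - c := by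
    rw [integral_sub hφ (integrable_const _)]
    simp
  rw [← h1]
  exact abs_integral_le_integral_abs

/-- Under concentration, the posterior expectation of the score of a fixed observation converges
to its value at the target. -/
lemma Concentrates.tendsto_score (hconc : Concentrates f Θ prior Γ θstar y)
    (hreg : Regular f Θ prior g Γ) (hid : Identified f Θ prior g Γ θstar) (z : E d)
    (k : Fin d) :
    Tendsto (fun q : ℕ × ℝ => ∫ θ, score f k q.2 z θ
        ∂postMeasure f Θ prior q.2 (fun i : Fin q.1 => y i) - score f k q.2 z (θstar q.2))
      (atTop ×ˢ 𝓟 Γ) (𝓝 0) := by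
  obtain ⟨h, henv, -⟩ := hreg.exists_isEnvelope
  obtain ⟨K, u, ht⟩ := hid.exists_tailBound hreg
  have hlim := hconc.tendsto_integral hreg
    (b := fun _ γ θ => |score f k γ z θ - score f k γ z (θstar γ)|) (C := 2 * (1 + h z))
    (fun _ _ _ _ _ => abs_nonneg _) (Eventually.of_forall fun _ γ hγ θ hθ => ?_)
    fun ε hε => ?_
  · refine squeeze_zero_norm' ?_ hlim
    rw [eventually_prod_principal_iff]
    exact Eventually.of_forall fun n γ hγ =>
      hreg.abs_integral_post_sub_le hγ _ (hreg.integrable_score_post hγ _ z k) _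
  · have h1 := henv.abs_score_le hγ hθ z k
    have h2 := henv.abs_score_le hγ (hid.mem γ hγ) z k
    exact (abs_sub _ _).trans (by linarith)
  · obtain ⟨δ, hδ, hn⟩ := ht.exists_near hreg hid
      (φ := fun q => |score f k q.1 z q.2 - score f k q.1 z (θstar q.1)|)
      ((hid.continuousOn_sub_star hreg (hreg.continuousOn_score k)).comp
        (f := fun q : ℝ × E p => (q, z)) (by fun_prop)
        fun q hq => ⟨⟨hq.1, ht.subset hq.2⟩, mem_univ _⟩) (by simp) hε
    exact ⟨δ, hδ, Eventually.of_forall fun n γ hγ θ hθ hd => (hn γ hγ θ hθ hd).2⟩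

end Discrepancy

/-! ### The score of the data density and the single-observation form of the Fisher divergence. -/

section DataScore

variable {n p d : ℕ} {f : E p → E d → ℝ} {Θ : Set (E p)} {prior : E p → ℝ} {g h : E d → ℝ}
  {Γ : Set ℝ} {θstar : ℝ → E p} {γ : ℝ}

/-- The partial derivative of `log g` (with value zero where `g` vanishes). -/
def dataScore (g : E d → ℝ) (k : Fin d) (y : E d) : ℝ := pderiv k g y / g y

lemma Regular.measurable_dataScore (hreg : Regular f Θ prior g Γ) (k : Fin d) :
    Measurable (dataScore g k) :=
  (continuous_pderiv hreg.data_contDiff).measurable.div hreg.measurable_density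

lemma Regular.pderiv_log_density (hreg : Regular f Θ prior g Γ) (k : Fin d) {y : E d}
    (hy : g y ≠ 0) : pderiv k (fun z => log (g z)) y = dataScore g k y := by
  have h1 := hasLineDerivAt_pderiv (k := k)
    (hreg.data_contDiff.differentiable (by norm_num) y)
  have h2 := HasDerivAt.log h1 (by simpa using hy)
  simp only [zero_smul, add_zero] at h2
  exact HasLineDerivAt.lineDeriv h2

/-- Where `g` vanishes, `dataScore` and the derivative of `log g` need not agree, but the weight `g`
removes those points. -/
lemma Regular.integrable_dataScore_sq (hreg : Regular f Θ prior g Γ) (k : Fin d) :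
    Integrable (fun y => dataScore g k y ^ 2) (dataLaw g) := by
  rw [hreg.integrable_data_iff]
  refine (hreg.data_fisher k).congr (Eventually.of_forall fun y => ?_)
  by_cases hy : g y = 0
  · simp [hy]
  · simp only [hreg.pderiv_log_density k hy]

lemma Regular.jointPderiv_log_prod (hreg : Regular f Θ prior g Γ) {y : Fin n → E d}
    (hy : ∏ j, g (y j) ≠ 0) (i : Fin n) (k : Fin d) :
    jointPderiv i k (fun z => log (∏ j, g (z j))) y = dataScore g k (y i) := by
  have h1 := hasLineDerivAt_pderiv (k := k)
    (hreg.data_contDiff.differentiable (by norm_num) (y i))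
  set c := ∏ j ∈ Finset.univ.erase i, g (y j) with hc
  have hgc : g (y i) * c = ∏ j, g (y j) :=
    Finset.mul_prod_erase _ (fun j => g (y j)) (Finset.mem_univ i)
  rw [← hgc] at hy
  have h2 := HasDerivAt.log (HasDerivAt.mul_const h1 c) (by simpa using hy)
  simp only [zero_smul, add_zero] at h2
  rw [mul_div_mul_right _ _ (right_ne_zero_of_mul hy)] at h2
  refine HasLineDerivAt.lineDeriv (f := fun z : Fin n → E d => log (∏ j, g (z j))) ?_
  refine h2.congr_of_eventuallyEq (Eventually.of_forall fun t => ?_)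
  simp only
  rw [← Finset.mul_prod_erase _ _ (Finset.mem_univ i)]
  congr 2
  · simp
  · refine Finset.prod_congr rfl fun j hj => ?_
    simp [Pi.single_eq_of_ne (Finset.ne_of_mem_erase hj)]

/-- The squared distance between the score of the data density at the `i`-th observation and the
posterior expectation of the score of the model. -/
def scoreGap (f : E p → E d → ℝ) (Θ : Set (E p)) (prior : E p → ℝ) (g : E d → ℝ) (γ : ℝ)
    (y : Fin n → E d) (i : Fin n) : ℝ :=
  ∑ k, (dataScore g k (y i) - ∫ θ, score f k γ (y i) θ ∂postMeasure f Θ prior γ y) ^ 2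

lemma Regular.marginalFisher_eq (hreg : Regular f Θ prior g Γ) (hγ : γ ∈ Γ) :
    marginalFisher f Θ prior g n γ
      = ∫ y, ∑ i, scoreGap f Θ prior g γ y i ∂(Measure.pi fun _ : Fin n => dataLaw g) := by
  rw [hreg.integral_pi_data, marginalFisher, jointFisherDivergence]
  congr with y
  by_cases hy : ∏ i, g (y i) = 0
  · simp [hy]
  · congr 1
    refine Finset.sum_congr rfl fun i _ => Finset.sum_congr rfl fun k _ => ?_
    rw [hreg.jointPderiv_log_prod hy, hreg.jointPderiv_log_marginal hγ]

/-- The posterior mean is measurable in the data because it is continuous in them; only `dataScore`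
may be discontinuous. -/
lemma Regular.measurable_scoreGap (hreg : Regular f Θ prior g Γ) (hγ : γ ∈ Γ) (i : Fin n) :
    Measurable (fun y : Fin n → E d => scoreGap f Θ prior g γ y i) := by
  obtain ⟨h, henv, -⟩ := hreg.exists_isEnvelope
  refine Finset.measurable_sum _ fun k _ => (Measurable.sub ?_ ?_).pow_const 2
  · exact (hreg.measurable_dataScore k).comp (measurable_pi_apply i)
  · have h1 := hreg.continuousOn_integral_post (ι := Fin n)
      (φ := fun γ θ y => score f k γ (y i) θ) (C := fun y => 1 + h (y i))
      ((hreg.continuousOn_score k).comp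
        (f := fun q : ℝ × E p × (Fin n → E d) => (q.1, q.2.1, q.2.2 i)) (by fun_prop)
        fun q hq => ⟨hq.1, hq.2.1, mem_univ _⟩)
      (continuous_const.add (henv.continuous.comp (continuous_apply i)))
      fun γ hγ θ hθ y => henv.abs_score_le hγ hθ _ k
    exact (h1.comp_continuous (f := fun y : Fin n → E d => (γ, y)) (by fun_prop)
      fun y => ⟨hγ, mem_univ _⟩).measurable

lemma sub_sq_le_of_sq_le {a b c : ℝ} (hb : b ^ 2 ≤ c) : (a - b) ^ 2 ≤ 2 * a ^ 2 + 2 * c := by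
  nlinarith [sq_nonneg (a + b)]

/-- The posterior mean of the score at y_i is at most √h(y_i). The resulting bound involves y_i
alone, not n, γ or the other data, and is what dominates the limit of the Fisher divergence. -/
lemma Regular.scoreGap_le (hreg : Regular f Θ prior g Γ) (henv : IsEnvelope f Θ Γ h)
    (hγ : γ ∈ Γ) (y : Fin n → E d) (i : Fin n) :
    scoreGap f Θ prior g γ y i ≤ ∑ k, (2 * dataScore g k (y i) ^ 2 + 2 * h (y i)) := by
  refine Finset.sum_le_sum fun k _ => sub_sq_le_of_sq_le ?_
  have h1 := hreg.abs_integral_post_le hγ y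
    fun θ hθ => henv.abs_score_le_sqrt hγ hθ (y i) k
  rw [← sq_abs, ← Real.sq_sqrt (henv.nonneg (y i))]
  exact pow_le_pow_left₀ (abs_nonneg _) h1 2

lemma scoreGap_nonneg (y : Fin n → E d) (i : Fin n) : 0 ≤ scoreGap f Θ prior g γ y i :=
  Finset.sum_nonneg fun _ _ => sq_nonneg _

lemma Regular.integrable_bound (hreg : Regular f Θ prior g Γ)
    (hi : Integrable (fun y => h y * g y)) :
    Integrable (fun y => ∑ k, (2 * dataScore g k y ^ 2 + 2 * h y)) (dataLaw g) :=
  integrable_finsetSum _ fun k _ => ((hreg.integrable_dataScore_sq k).const_mul 2).add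
    ((hreg.integrable_data_iff.2 hi).const_mul 2)

/-- The posterior sees the data only through a symmetric sum. -/
lemma scoreGap_perm (y : Fin n → E d) (e : Equiv.Perm (Fin n)) (i : Fin n) :
    scoreGap f Θ prior g γ (fun j => y (e j)) i = scoreGap f Θ prior g γ y (e i) := by
  have : postMeasure f Θ prior γ (fun j => y (e j)) = postMeasure f Θ prior γ y := by
    unfold postMeasure
    congr 1
    funext θ
    exact Equiv.sum_comp e fun j => logLik f γ (y j) θ
  simp only [scoreGap, this]

lemma measurePreserving_perm {X : Type*} [MeasurableSpace X] (μ : Measure X) [SigmaFinite μ]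
    (e : Equiv.Perm (Fin n)) :
    MeasurePreserving (fun (y : Fin n → X) j => y (e j)) (Measure.pi fun _ => μ)
      (Measure.pi fun _ => μ) := by
  have h1 := measurePreserving_piCongrLeft (fun _ : Fin n => μ) e.symm
  convert h1 using 1
  funext y j
  have := Equiv.piCongrLeft_apply_apply (fun _ => X) e.symm y (e j)
  simpa [MeasurableEquiv.coe_piCongrLeft] using this.symm

lemma Regular.integral_scoreGap_eq (hreg : Regular f Θ prior g Γ) (hγ : γ ∈ Γ) (i j : Fin n) :
    ∫ y, scoreGap f Θ prior g γ y i ∂(Measure.pi fun _ : Fin n => dataLaw g)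
      = ∫ y, scoreGap f Θ prior g γ y j ∂(Measure.pi fun _ : Fin n => dataLaw g) := by
  have := hreg.isProbabilityMeasure_data
  have h1 := measurePreserving_perm (dataLaw g) (Equiv.swap i j)
  have h2 : ∀ y : Fin n → E d, scoreGap f Θ prior g γ y i
      = scoreGap f Θ prior g γ (fun l => y (Equiv.swap i j l)) j := fun y => by
    rw [scoreGap_perm, Equiv.swap_apply_right]
  simp_rw [h2]
  rw [← integral_map h1.measurable.aemeasurable
    (hreg.measurable_scoreGap hγ j).aestronglyMeasurable, h1.map_eq]

lemma Regular.integrable_scoreGap (hreg : Regular f Θ prior g Γ) (hγ : γ ∈ Γ) (i : Fin n) :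
    Integrable (fun y : Fin n → E d => scoreGap f Θ prior g γ y i)
      (Measure.pi fun _ : Fin n => dataLaw g) := by
  have := hreg.isProbabilityMeasure_data
  obtain ⟨h, henv, hi⟩ := hreg.exists_isEnvelope
  refine ((measurePreserving_eval (fun _ : Fin n => dataLaw g) i).integrable_comp_of_integrable
    (hreg.integrable_bound hi)).mono' (hreg.measurable_scoreGap hγ i).aestronglyMeasurable
    (Eventually.of_forall fun y => ?_)
  rw [Real.norm_of_nonneg (scoreGap_nonneg y i)]
  exact hreg.scoreGap_le henv hγ y i

/-- By exchangeability, the Fisher divergence per observation is the contribution of a single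
observation. -/
lemma Regular.marginalFisher_div (hreg : Regular f Θ prior g Γ) (hγ : γ ∈ Γ) (i : Fin n) :
    marginalFisher f Θ prior g n γ / n
      = ∫ y, scoreGap f Θ prior g γ y i ∂(Measure.pi fun _ : Fin n => dataLaw g) := by
  have hn : (n : ℝ) ≠ 0 := by exact_mod_cast (i.pos).ne'
  rw [hreg.marginalFisher_eq hγ, integral_finsetSum _ fun j _ => hreg.integrable_scoreGap hγ j,
    Finset.sum_congr rfl fun j _ => hreg.integral_scoreGap_eq hγ j i]
  simp
  field_simp

/-- The squared distance between the score of the data density and that of the model at the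
target. -/
def targetGap (f : E p → E d → ℝ) (g : E d → ℝ) (θstar : ℝ → E p) (γ : ℝ) (y : E d) : ℝ :=
  ∑ k, (dataScore g k y - score f k γ y (θstar γ)) ^ 2

lemma Regular.fisherDivergence_eq (hreg : Regular f Θ prior g Γ) (θstar : ℝ → E p) (γ : ℝ) :
    fisherDivergence g (fun y => exp (logLik f γ y (θstar γ)))
      = ∫ y, targetGap f g θstar γ y ∂dataLaw g := by
  rw [hreg.integral_data, fisherDivergence]
  congr with y
  by_cases hy : g y = 0
  · simp [hy]
  · congr 1
    refine Finset.sum_congr rfl fun k _ => ?_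
    rw [hreg.pderiv_log_density k hy]
    simp only [log_exp]
    rfl

lemma Regular.measurable_score (hreg : Regular f Θ prior g Γ) (γ : ℝ) {θ : E p} (hθ : θ ∈ Θ)
    (k : Fin d) : Measurable (fun y => score f k γ y θ) :=
  (contDiff_pderiv (hreg.contDiff_logLik γ hθ)).continuous.measurable

lemma Regular.measurable_targetGap (hreg : Regular f Θ prior g Γ)
    (hid : Identified f Θ prior g Γ θstar) (hγ : γ ∈ Γ) :
    Measurable (targetGap f g θstar γ) :=
  Finset.measurable_sum _ fun k _ => ((hreg.measurable_dataScore k).sub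
    (hreg.measurable_score γ (hid.mem γ hγ) k)).pow_const 2

lemma IsEnvelope.targetGap_le (henv : IsEnvelope f Θ Γ h)
    (hid : Identified f Θ prior g Γ θstar) (hγ : γ ∈ Γ) (y : E d) :
    targetGap f g θstar γ y ≤ ∑ k, (2 * dataScore g k y ^ 2 + 2 * h y) :=
  Finset.sum_le_sum fun k _ =>
    sub_sq_le_of_sq_le (henv.score_sq_le γ hγ _ (hid.mem γ hγ) y k)

lemma targetGap_nonneg (y : E d) : 0 ≤ targetGap f g θstar γ y :=
  Finset.sum_nonneg fun _ _ => sq_nonneg _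

end DataScore

/-! ### The limit of the Fisher divergence per observation. -/

section FisherRate

variable {p d : ℕ} {f : E p → E d → ℝ} {Θ : Set (E p)} {prior : E p → ℝ} {g h : E d → ℝ}
  {Γ : Set ℝ} {θstar : ℝ → E p} {Ω : Type*} [MeasurableSpace Ω] {P : Measure Ω}
  {Y : ℕ → Ω → E d}

/-- The uniform law on Γ × K controls L and the ordinary strong law controls `u`; a single null set
serves all γ. -/
theorem Identified.ae_concentrates (hreg : Regular f Θ prior g Γ)
    (hid : Identified f Θ prior g Γ θstar) (hlaw : ∀ i, HasLaw (Y i) (dataLaw g) P)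
    (hindep : iIndepFun Y P) : ∀ᵐ ω ∂P, Concentrates f Θ prior Γ θstar (fun i => Y i ω) := by
  obtain ⟨K, u, ht⟩ := hid.exists_tailBound hreg
  obtain ⟨h, henv, hi⟩ := hreg.exists_isEnvelope
  have h1 := tendstoUniformlyOn_average hlaw hindep
    (hreg.isCompact_tuning.prod ht.isCompact) (φ := fun q y => logLik f q.1 y q.2)
    ((continuousOn_assoc hreg.continuousOn_logLik).mono
      (prod_mono_left (prod_mono_right ht.subset)))
    (hreg.integrable_data_iff.2 hi)
    fun q hq => henv.abs_logLik_le _ hq.1 _ (ht.subset hq.2)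
  filter_upwards [h1, tendsto_average hlaw hindep ht.integrable] with ω hω hω'
  exact ht.concentrates hreg hid hω hω'

/-- Pointwise convergence of the gap between the scores of the data and of the posterior. -/
lemma Concentrates.tendsto_scoreGap {y : ℕ → E d} (hconc : Concentrates f Θ prior Γ θstar y)
    (hreg : Regular f Θ prior g Γ) (hid : Identified f Θ prior g Γ θstar) :
    Tendsto (fun q : ℕ × ℝ =>
      ∑ k, (dataScore g k (y 0) - ∫ θ, score f k q.2 (y 0) θ
        ∂postMeasure f Θ prior q.2 (fun i : Fin q.1 => y i)) ^ 2
        - targetGap f g θstar q.2 (y 0)) (atTop ×ˢ 𝓟 Γ) (𝓝 0) := by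
  obtain ⟨h, henv, -⟩ := hreg.exists_isEnvelope
  simp only [targetGap, ← Finset.sum_sub_distrib]
  rw [show (0 : ℝ) = ∑ _k : Fin d, (0 : ℝ) by simp]
  refine tendsto_finsetSum _ fun k _ => ?_
  -- The difference (s - a)² - (s - b)² factors as (2s - a - b)(b - a), and the constant here bounds
  -- the first factor.
  have h1 := (hconc.tendsto_score hreg hid (y 0) k).abs.const_mul
    (2 * |dataScore g k (y 0)| + 2 * (1 + h (y 0)))
  rw [abs_zero, mul_zero] at h1
  refine squeeze_zero_norm' ?_ h1
  rw [eventually_prod_principal_iff]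
  refine Eventually.of_forall fun n γ hγ => ?_
  have h2 := hreg.abs_integral_post_le hγ (fun i : Fin n => y i)
    fun θ hθ => henv.abs_score_le hγ hθ (y 0) k
  have h3 := henv.abs_score_le hγ (hid.mem γ hγ) (y 0) k
  dsimp only
  generalize ∫ θ, score f k γ (y 0) θ ∂postMeasure f Θ prior γ (fun i : Fin n => y i) = a at *
  generalize score f k γ (y 0) (θstar γ) = b at *
  generalize dataScore g k (y 0) = s at *
  rw [Real.norm_eq_abs, show (s - a) ^ 2 - (s - b) ^ 2 = (2 * s - (a + b)) * -(a - b) by ring,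
    abs_mul, abs_neg]
  refine mul_le_mul_of_nonneg_right ?_ (abs_nonneg _)
  have h4 := abs_sub (2 * s) (a + b)
  have h5 := abs_add_le a b
  rw [abs_mul, abs_two] at h4
  linarith

/-- The Fisher divergence per observation converges uniformly to its value at the target. -/
theorem Identified.tendsto_marginalFisher [IsProbabilityMeasure P]
    (hreg : Regular f Θ prior g Γ)
    (hid : Identified f Θ prior g Γ θstar) (hlaw : ∀ i, HasLaw (Y i) (dataLaw g) P)
    (hindep : iIndepFun Y P) :
    Tendsto (fun q : ℕ × ℝ => marginalFisher f Θ prior g q.1 q.2 / q.1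
      - fisherDivergence g (fun y => exp (logLik f q.2 y (θstar q.2)))) (atTop ×ˢ 𝓟 Γ)
      (𝓝 0) := by
  obtain ⟨h, henv, hi⟩ := hreg.exists_isEnvelope
  have := hreg.isProbabilityMeasure_data
  have hmap : ∀ n : ℕ, P.map (fun ω (i : Fin n) => Y i ω) = Measure.pi fun _ => dataLaw g := by
    intro n
    rw [(iIndepFun_iff_map_fun_eq_pi_map fun i : Fin n => (hlaw i).aemeasurable).1
      (hindep.precomp Fin.val_injective)]
    simp only [fun i => (hlaw i).map_eq]
  have hYm : ∀ n : ℕ, AEMeasurable (fun ω (i : Fin n) => Y i ω) P := fun n =>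
    aemeasurable_pi_lambda _ fun i => (hlaw i).aemeasurable
  -- This is the contribution of observation 0, written so that it makes sense for n = 0 too; it is
  -- a `scoreGap` only for n ≥ 1.
  set G : ℕ × ℝ → Ω → ℝ := fun q ω =>
    ∑ k, (dataScore g k (Y 0 ω) - ∫ θ, score f k q.2 (Y 0 ω) θ
      ∂postMeasure f Θ prior q.2 (fun i : Fin q.1 => Y i ω)) ^ 2 with hG
  set B : E d → ℝ := fun y => ∑ k, (2 * dataScore g k y ^ 2 + 2 * h y) with hB
  have hBi : Integrable (fun ω => B (Y 0 ω)) P :=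
    (integrable_map_measure (f := Y 0) (g := B) (by
      rw [(hlaw 0).map_eq]; exact (hreg.integrable_bound hi).aestronglyMeasurable)
      (hlaw 0).aemeasurable).1 (by rw [(hlaw 0).map_eq]; exact hreg.integrable_bound hi)
  have hGm : ∀ n ≥ 1, ∀ γ ∈ Γ, AEStronglyMeasurable (G (n, γ)) P ∧
      marginalFisher f Θ prior g n γ / n = ∫ ω, G (n, γ) ω ∂P := by
    intro n hn γ hγ
    have hm := hreg.measurable_scoreGap (n := n) hγ ⟨0, hn⟩
    refine ⟨(hm.comp_aemeasurable (hYm n)).aestronglyMeasurable, ?_⟩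
    rw [hreg.marginalFisher_div hγ ⟨0, hn⟩, ← hmap,
      integral_map (hYm n) hm.aestronglyMeasurable]
    rfl
  have hTm : ∀ γ ∈ Γ, AEStronglyMeasurable (fun ω => targetGap f g θstar γ (Y 0 ω)) P :=
    fun γ hγ => ((hreg.measurable_targetGap hid hγ).comp_aemeasurable
      (hlaw 0).aemeasurable).aestronglyMeasurable
  have hGle : ∀ n ≥ 1, ∀ γ ∈ Γ, ∀ ω, 0 ≤ G (n, γ) ω ∧ G (n, γ) ω ≤ B (Y 0 ω) :=
    fun n hn γ hγ ω => ⟨scoreGap_nonneg (fun i : Fin n => Y i ω) ⟨0, hn⟩,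
      hreg.scoreGap_le henv hγ (fun i : Fin n => Y i ω) ⟨0, hn⟩⟩
  have hTle : ∀ γ ∈ Γ, ∀ ω, 0 ≤ targetGap f g θstar γ (Y 0 ω) ∧
      targetGap f g θstar γ (Y 0 ω) ≤ B (Y 0 ω) := fun γ hγ ω =>
    ⟨targetGap_nonneg _, henv.targetGap_le hid hγ _⟩
  -- Dominated convergence along the product filter, with a bound free of (n, γ), gives convergence
  -- uniform in γ at once.
  have hlim : Tendsto (fun q : ℕ × ℝ => ∫ ω, (G q ω - targetGap f g θstar q.2 (Y 0 ω)) ∂P)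
      (atTop ×ˢ 𝓟 Γ) (𝓝 (∫ _, 0 ∂P)) := by
    refine tendsto_integral_filter_of_dominated_convergence (fun ω => B (Y 0 ω)) ?_ ?_ hBi ?_
    · rw [eventually_prod_principal_iff]
      filter_upwards [eventually_ge_atTop 1] with n hn γ hγ
      exact (hGm n hn γ hγ).1.sub (hTm γ hγ)
    · rw [eventually_prod_principal_iff]
      filter_upwards [eventually_ge_atTop 1] with n hn γ hγ
      refine Eventually.of_forall fun ω => ?_
      obtain ⟨h1, h2⟩ := hGle n hn γ hγ ω
      obtain ⟨h3, h4⟩ := hTle γ hγ ω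
      exact abs_le.2 ⟨by linarith, by linarith⟩
    · filter_upwards [hid.ae_concentrates hreg hlaw hindep] with ω hω
      exact hω.tendsto_scoreGap hreg hid
  rw [integral_zero] at hlim
  refine hlim.congr' ?_
  rw [EventuallyEq, eventually_prod_principal_iff]
  filter_upwards [eventually_ge_atTop 1] with n hn γ hγ
  have hGi : Integrable (G (n, γ)) P := hBi.mono' (hGm n hn γ hγ).1
    (Eventually.of_forall fun ω => by
      rw [Real.norm_of_nonneg (hGle n hn γ hγ ω).1]; exact (hGle n hn γ hγ ω).2)
  have hTi : Integrable (fun ω => targetGap f g θstar γ (Y 0 ω)) P := hBi.mono' (hTm γ hγ)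
    (Eventually.of_forall fun ω => by
      rw [Real.norm_of_nonneg (hTle γ hγ ω).1]; exact (hTle γ hγ ω).2)
  rw [integral_sub hGi hTi, (hGm n hn γ hγ).2, hreg.fisherDivergence_eq, ← (hlaw 0).map_eq,
    integral_map (hlaw 0).aemeasurable
      (hreg.measurable_targetGap hid hγ).aestronglyMeasurable]

/-- The limit defining the Fisher divergence per observation. -/
theorem Identified.fisherRate_eq [IsProbabilityMeasure P]
    (hreg : Regular f Θ prior g Γ)
    (hid : Identified f Θ prior g Γ θstar) (hlaw : ∀ i, HasLaw (Y i) (dataLaw g) P)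
    (hindep : iIndepFun Y P) {γ : ℝ} (hγ : γ ∈ Γ) :
    fisherRate f Θ prior g γ = fisherDivergence g (fun y => exp (logLik f γ y (θstar γ))) := by
  have h1 := (hid.tendsto_marginalFisher hreg hlaw hindep).comp
    (tendsto_id.prodMk (tendsto_principal.2 (Eventually.of_forall fun _ : ℕ => hγ)))
  refine Tendsto.limUnder_eq ?_
  simpa [Function.comp_def] using h1.add_const
    (fisherDivergence g (fun y => exp (logLik f γ y (θstar γ))))

theorem Identified.tendstoUniformlyOn_marginalFisher [IsProbabilityMeasure P]
    (hreg : Regular f Θ prior g Γ)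
    (hid : Identified f Θ prior g Γ θstar) (hlaw : ∀ i, HasLaw (Y i) (dataLaw g) P)
    (hindep : iIndepFun Y P) :
    TendstoUniformlyOn (fun (n : ℕ) (γ : ℝ) => marginalFisher f Θ prior g n γ / n)
      (fisherRate f Θ prior g) atTop Γ := by
  rw [Metric.tendstoUniformlyOn_iff]
  intro ε hε
  have h1 := Metric.tendsto_nhds.1 (hid.tendsto_marginalFisher hreg hlaw hindep) ε hε
  rw [eventually_prod_principal_iff] at h1
  filter_upwards [h1] with n hn γ hγ
  have h2 := hn γ hγ
  rw [Real.dist_eq, sub_zero] at h2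
  rwa [hid.fisherRate_eq hreg hlaw hindep hγ, dist_comm, Real.dist_eq]

end FisherRate

/-! ### Convergence of minimisers. -/

/-- Minimisers of uniformly convergent functions converge to a unique minimiser of the limit. -/
theorem tendsto_of_isMinOn {T : Type*} [TopologicalSpace T] {Γ : Set T} (hΓ : IsCompact Γ)
    {F : ℕ → T → ℝ} {H : T → ℝ} (hH : ContinuousOn H Γ)
    (hF : Tendsto (fun q : ℕ × T => F q.1 q.2 - H q.2) (atTop ×ˢ 𝓟 Γ) (𝓝 0)) {t₀ : T}
    (ht₀ : t₀ ∈ Γ) (hmin : ∀ t ∈ Γ, t ≠ t₀ → H t₀ < H t) {t : ℕ → T}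
    (ht : ∀ᶠ n in atTop, t n ∈ Γ ∧ IsMinOn (F n) Γ (t n)) : Tendsto t atTop (𝓝 t₀) := by
  refine (nhds_basis_opens t₀).tendsto_right_iff.2 fun U ⟨hU₀, hU⟩ => ?_
  have hA : IsCompact (Γ \ U) := hΓ.diff hU
  rcases (Γ \ U).eq_empty_or_nonempty with he | hne
  · exact ht.mono fun n hn => (sdiff_eq_empty.1 he) hn.1
  · obtain ⟨a, ha, hamin⟩ := hA.exists_isMinOn hne (hH.mono sdiff_subset)
    have hlt : H t₀ < H a := hmin a ha.1 fun h => ha.2 (h ▸ hU₀)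
    -- Off `U` the limit exceeds `H t₀` by at least `H a - H t₀`; errors below half of this cannot
    -- make such a point a minimiser.
    have h1 := Metric.tendsto_nhds.1 hF ((H a - H t₀) / 2) (by linarith)
    rw [eventually_prod_principal_iff] at h1
    filter_upwards [h1, ht] with n hn htn
    by_contra hnU
    have h2 := hn _ htn.1
    have h3 := hn _ ht₀
    rw [Real.dist_eq, sub_zero] at h2 h3
    have h4 : H a ≤ H (t n) := hamin ⟨htn.1, hnU⟩
    have h5 : F n (t n) ≤ F n t₀ := htn.2 ht₀
    have h6 := (abs_lt.1 h2).1
    have h7 := (abs_lt.1 h3).2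
    linarith

/-! ### Fisher divergence as expected Hyvärinen score. -/

section IntegrationByParts

variable {p d : ℕ} {f : E p → E d → ℝ} {Θ : Set (E p)} {prior : E p → ℝ} {g h : E d → ℝ}
  {Γ : Set ℝ} {θstar : ℝ → E p} {γ : ℝ} {θ : E p}

/-- A zero of the nonnegative `g` is a minimum, so the gradient vanishes there too and the
convention x / 0 = 0 does no harm. -/
lemma Regular.dataScore_mul (hreg : Regular f Θ prior g Γ) (k : Fin d) (y : E d) :
    dataScore g k y * g y = pderiv k g y := by
  by_cases hy : g y = 0
  · have hmin : IsLocalMin g y :=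
      Eventually.of_forall fun z => hy.trans_le (hreg.data_nonneg z)
    rw [hy, mul_zero, pderiv_eq_fderiv (hreg.data_contDiff.differentiable (by norm_num) y),
      hmin.fderiv_eq_zero]
    rfl
  · rw [dataScore, div_mul_cancel₀ _ hy]

lemma Regular.integrable_of_le_envelope (hreg : Regular f Θ prior g Γ)
    (hi : Integrable (fun y => h y * g y)) {φ : E d → ℝ} (hφ : Measurable φ) {a b : ℝ}
    (hb : ∀ y, |φ y| ≤ a + b * h y) : Integrable φ (dataLaw g) := by
  have := hreg.isProbabilityMeasure_data
  exact ((integrable_const a).add ((hreg.integrable_data_iff.2 hi).const_mul b)).mono'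
    hφ.aestronglyMeasurable (Eventually.of_forall hb)

lemma Regular.integrable_score (hreg : Regular f Θ prior g Γ) (hγ : γ ∈ Γ) (hθ : θ ∈ Θ)
    (k : Fin d) : Integrable (fun y => score f k γ y θ) (dataLaw g) := by
  obtain ⟨h, henv, hi⟩ := hreg.exists_isEnvelope
  exact hreg.integrable_of_le_envelope hi (hreg.measurable_score γ hθ k) (a := 1) (b := 1)
    fun y => by simpa using henv.abs_score_le hγ hθ y k

lemma Regular.integrable_score_sq (hreg : Regular f Θ prior g Γ) (hγ : γ ∈ Γ) (hθ : θ ∈ Θ)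
    (k : Fin d) : Integrable (fun y => score f k γ y θ ^ 2) (dataLaw g) := by
  obtain ⟨h, henv, hi⟩ := hreg.exists_isEnvelope
  exact hreg.integrable_of_le_envelope hi ((hreg.measurable_score γ hθ k).pow_const 2) (a := 0)
    (b := 1) fun y => by simpa using henv.score_sq_le γ hγ θ hθ y k

lemma Regular.integrable_score₂ (hreg : Regular f Θ prior g Γ) (hγ : γ ∈ Γ) (hθ : θ ∈ Θ)
    (k : Fin d) : Integrable (fun y => score₂ f k γ y θ) (dataLaw g) := by
  obtain ⟨h, henv, hi⟩ := hreg.exists_isEnvelope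
  exact hreg.integrable_of_le_envelope hi
    (continuous_pderiv (contDiff_pderiv (hreg.contDiff_logLik γ hθ))).measurable (a := 0)
    (b := 1) fun y => by simpa using henv.abs_score₂_le γ hγ θ hθ y k

lemma Regular.integrable_dataScore_mul_score (hreg : Regular f Θ prior g Γ) (hγ : γ ∈ Γ)
    (hθ : θ ∈ Θ) (k : Fin d) :
    Integrable (fun y => dataScore g k y * score f k γ y θ) (dataLaw g) := by
  refine ((hreg.integrable_dataScore_sq k).add (hreg.integrable_score_sq hγ hθ k)).mono'
    ((hreg.measurable_dataScore k).mul (hreg.measurable_score γ hθ k)).aestronglyMeasurable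
    (Eventually.of_forall fun y => abs_le.2 ⟨?_, ?_⟩)
  · simp only [Pi.add_apply]
    nlinarith [sq_nonneg (dataScore g k y + score f k γ y θ), sq_nonneg (dataScore g k y),
      sq_nonneg (score f k γ y θ)]
  · simp only [Pi.add_apply]
    nlinarith [sq_nonneg (dataScore g k y - score f k γ y θ), sq_nonneg (dataScore g k y),
      sq_nonneg (score f k γ y θ)]

/-- Integration by parts for the cross term of the Fisher divergence. -/
lemma Regular.integral_dataScore_mul_score (hreg : Regular f Θ prior g Γ) (hγ : γ ∈ Γ)
    (hθ : θ ∈ Θ) (k : Fin d) :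
    ∫ y, dataScore g k y * score f k γ y θ ∂dataLaw g = -∫ y, score₂ f k γ y θ ∂dataLaw g := by
  have he : ∀ y, dataScore g k y * score f k γ y θ * g y = score f k γ y θ * pderiv k g y :=
    fun y => by rw [← hreg.dataScore_mul]; ring
  have h1 := hreg.integrable_data_iff.1 (hreg.integrable_dataScore_mul_score hγ hθ k)
  simp_rw [he] at h1
  rw [hreg.integral_data, hreg.integral_data]
  simp_rw [he]
  -- No boundary term arises on the whole space, because the product of the score with `g` and both
  -- terms of its derivative are integrable.
  exact integral_bilinear_hasLineDerivAt_right_eq_neg_left_of_integrable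
    (B := ContinuousLinearMap.mul ℝ ℝ) (v := EuclideanSpace.single k 1)
    (hreg.integrable_data_iff.1 (hreg.integrable_score₂ hγ hθ k)) h1
    (hreg.integrable_data_iff.1 (hreg.integrable_score hγ hθ k))
    (fun y _ => hreg.hasLineDerivAt_score γ hθ k y)
    (fun y _ => hasLineDerivAt_pderiv (hreg.data_contDiff.differentiable (by norm_num) y))

/-- The Hyvärinen score of one observation under the pseudo-likelihood at the target. -/
def targetScore (f : E p → E d → ℝ) (θstar : ℝ → E p) (γ : ℝ) (y : E d) : ℝ :=
  ∑ k, (2 * (score₂ f k γ y (θstar γ) + score f k γ y (θstar γ) ^ 2)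
    - score f k γ y (θstar γ) ^ 2)

/-- The Fisher divergence is the expected Hyvärinen score up to a constant. -/
lemma Regular.integral_targetGap (hreg : Regular f Θ prior g Γ)
    (hid : Identified f Θ prior g Γ θstar) (hγ : γ ∈ Γ) :
    ∫ y, targetGap f g θstar γ y ∂dataLaw g
      = ∑ k, ∫ y, dataScore g k y ^ 2 ∂dataLaw g
        + ∫ y, targetScore f θstar γ y ∂dataLaw g := by
  have hθ := hid.mem γ hγ
  have h1 : ∀ k, Integrable (fun y => 2 * (dataScore g k y * score f k γ y (θstar γ)))
    (dataLaw g) := fun k => (hreg.integrable_dataScore_mul_score hγ hθ k).const_mul 2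
  have h2 : ∀ k, Integrable (fun y => score f k γ y (θstar γ) ^ 2) (dataLaw g) :=
    hreg.integrable_score_sq hγ hθ
  have h3 : ∀ k, Integrable (fun y => 2 * score₂ f k γ y (θstar γ)) (dataLaw g) := fun k =>
    (hreg.integrable_score₂ hγ hθ k).const_mul 2
  have h4 : ∀ k, Integrable (fun y => dataScore g k y ^ 2) (dataLaw g) :=
    hreg.integrable_dataScore_sq
  have hgap : ∀ y, targetGap f g θstar γ y = ∑ k, (dataScore g k y ^ 2
      - 2 * (dataScore g k y * score f k γ y (θstar γ)) + score f k γ y (θstar γ) ^ 2) :=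
    fun y => Finset.sum_congr rfl fun k _ => by ring
  have hsc : ∀ y, targetScore f θstar γ y = ∑ k, (2 * score₂ f k γ y (θstar γ)
      + score f k γ y (θstar γ) ^ 2) := fun y => Finset.sum_congr rfl fun k _ => by ring
  have h5 : ∀ k, Integrable (fun y => dataScore g k y ^ 2
      - 2 * (dataScore g k y * score f k γ y (θstar γ))) (dataLaw g) := fun k => (h4 k).sub (h1 k)
  simp_rw [hgap, hsc]
  rw [integral_finsetSum, integral_finsetSum, ← Finset.sum_add_distrib]
  rotate_left
  · exact fun k _ => (h3 k).add (h2 k)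
  · exact fun k _ => (h5 k).add (h2 k)
  refine Finset.sum_congr rfl fun k _ => ?_
  rw [integral_add (h5 k) (h2 k), integral_sub (h4 k) (h1 k),
    integral_add (h3 k) (h2 k), integral_const_mul, integral_const_mul,
    hreg.integral_dataScore_mul_score hγ hθ]
  ring

end IntegrationByParts

/-! ### Uniform convergence of the score and consistency of its minimisers. -/

section ScoreConvergence

variable {n p d : ℕ} {f : E p → E d → ℝ} {Θ : Set (E p)} {prior : E p → ℝ} {g h : E d → ℝ}
  {Γ : Set ℝ} {θstar : ℝ → E p} {γ : ℝ} {θ : E p}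

lemma Regular.hScore_eq (hreg : Regular f Θ prior g Γ) (γ : ℝ) (y : Fin n → E d) :
    hScore f Θ prior γ y = ∑ i, ∑ k,
      (2 * ∫ θ, (score₂ f k γ (y i) θ + score f k γ (y i) θ ^ 2) ∂postMeasure f Θ prior γ y
        - (∫ θ, score f k γ (y i) θ ∂postMeasure f Θ prior γ y) ^ 2) := by
  simp only [hScore, hreg.postExp_eq]
  rfl

lemma Regular.continuousOn_score₂_add (hreg : Regular f Θ prior g Γ) (k : Fin d) :
    ContinuousOn (fun q : ℝ × E p × E d => score₂ f k q.1 q.2.2 q.2.1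
      + score f k q.1 q.2.2 q.2.1 ^ 2) (Γ ×ˢ Θ ×ˢ univ) :=
  (hreg.continuousOn_score₂ k).add ((hreg.continuousOn_score k).pow 2)

lemma IsEnvelope.abs_score₂_add_le (henv : IsEnvelope f Θ Γ h) (hγ : γ ∈ Γ) (hθ : θ ∈ Θ)
    (y : E d) (k : Fin d) : |score₂ f k γ y θ + score f k γ y θ ^ 2| ≤ 2 * h y := by
  have h1 := henv.abs_score₂_le γ hγ θ hθ y k
  have h2 := henv.score_sq_le γ hγ θ hθ y k
  have h3 := abs_add_le (score₂ f k γ y θ) (score f k γ y θ ^ 2)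
  rw [abs_of_nonneg (sq_nonneg (score f k γ y θ))] at h3
  linarith

/-- The score depends continuously on the tuning parameter. -/
lemma Regular.continuousOn_hScore (hreg : Regular f Θ prior g Γ) (y : Fin n → E d) :
    ContinuousOn (fun γ => hScore f Θ prior γ y) Γ := by
  obtain ⟨h, henv, -⟩ := hreg.exists_isEnvelope
  simp_rw [hreg.hScore_eq]
  have hmap : ∀ i : Fin n, ∀ φ : ℝ → E d → E p → ℝ,
      ContinuousOn (fun q : ℝ × E p × E d => φ q.1 q.2.2 q.2.1) (Γ ×ˢ Θ ×ˢ univ) →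
      (∀ γ ∈ Γ, ∀ θ ∈ Θ, ∀ z, |φ γ z θ| ≤ 1 + 2 * h z) →
      ContinuousOn (fun γ => ∫ θ, φ γ (y i) θ ∂postMeasure f Θ prior γ y) Γ := by
    intro i φ hφ hb
    have h1 := hreg.continuousOn_integral_post (ι := Fin n)
      (φ := fun γ θ y => φ γ (y i) θ) (C := fun y => 1 + 2 * h (y i))
      (hφ.comp (f := fun q : ℝ × E p × (Fin n → E d) => (q.1, q.2.1, q.2.2 i)) (by fun_prop)
        fun q hq => ⟨hq.1, hq.2.1, mem_univ _⟩)
      (continuous_const.add (continuous_const.mul (henv.continuous.comp (continuous_apply i))))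
      fun γ hγ θ hθ y => hb γ hγ θ hθ _
    exact h1.comp (f := fun γ : ℝ => (γ, y)) (by fun_prop) fun γ hγ => ⟨hγ, mem_univ _⟩
  refine continuousOn_finsetSum _ fun i _ => continuousOn_finsetSum _ fun k _ =>
    (continuousOn_const.mul (hmap i (fun γ z θ => score₂ f k γ z θ + score f k γ z θ ^ 2)
      (hreg.continuousOn_score₂_add k) ?_)).sub
      ((hmap i (fun γ z θ => score f k γ z θ) (hreg.continuousOn_score k) ?_).pow 2)
  · exact fun γ hγ θ hθ z => (henv.abs_score₂_add_le hγ hθ z k).trans (by linarith)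
  · exact fun γ hγ θ hθ z => (henv.abs_score_le hγ hθ z k).trans
      (by have := henv.nonneg z; linarith)

/-- A bound for the effect on the Hyvärinen score of one observation of replacing the target by
another parameter. -/
def scoreDist (f : E p → E d → ℝ) (h : E d → ℝ) (θstar : ℝ → E p) (γ : ℝ) (y : E d)
    (θ : E p) : ℝ :=
  ∑ k, (2 * |(score₂ f k γ y θ + score f k γ y θ ^ 2)
      - (score₂ f k γ y (θstar γ) + score f k γ y (θstar γ) ^ 2)|
    + 2 * √(h y) * |score f k γ y θ - score f k γ y (θstar γ)|)

lemma Identified.continuousOn_scoreDist (hreg : Regular f Θ prior g Γ)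
    (hid : Identified f Θ prior g Γ θstar) (henv : IsEnvelope f Θ Γ h) :
    ContinuousOn (fun q : (ℝ × E p) × E d => scoreDist f h θstar q.1.1 q.2 q.1.2)
      ((Γ ×ˢ Θ) ×ˢ univ) := by
  refine continuousOn_finsetSum _ fun k _ => ((continuousOn_const.mul
    (hid.continuousOn_sub_star hreg
      (φ := fun γ y θ => score₂ f k γ y θ + score f k γ y θ ^ 2)
      (hreg.continuousOn_score₂_add k))).add ((Continuous.continuousOn ?_).mul
    (hid.continuousOn_sub_star hreg (hreg.continuousOn_score k))))
  have := henv.continuous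
  fun_prop

lemma scoreDist_nonneg (y : E d) : 0 ≤ scoreDist f h θstar γ y θ :=
  Finset.sum_nonneg fun _ _ => by positivity

lemma scoreDist_star (y : E d) : scoreDist f h θstar γ y (θstar γ) = 0 := by
  simp [scoreDist]

/-- Per coordinate, the second-order part is at most 2(2h + 2h) = 8h and the other at most 2√h · 2√h
= 4h. Bounding scores by √h rather than 1 + h keeps the product linear in `h`, hence integrable. -/
lemma IsEnvelope.scoreDist_le (henv : IsEnvelope f Θ Γ h)
    (hid : Identified f Θ prior g Γ θstar) (hγ : γ ∈ Γ) (hθ : θ ∈ Θ) (y : E d) :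
    scoreDist f h θstar γ y θ ≤ 12 * d * h y := by
  have hs := hid.mem γ hγ
  calc scoreDist f h θstar γ y θ ≤ ∑ _k : Fin d, 12 * h y := by
        refine Finset.sum_le_sum fun k _ => ?_
        have h1 := henv.abs_score₂_add_le hγ hθ y k
        have h2 := henv.abs_score₂_add_le hγ hs y k
        have h3 := henv.abs_score_le_sqrt hγ hθ y k
        have h4 := henv.abs_score_le_sqrt hγ hs y k
        have h5 := (abs_sub (score₂ f k γ y θ + score f k γ y θ ^ 2)
          (score₂ f k γ y (θstar γ) + score f k γ y (θstar γ) ^ 2))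
        have h6 := (abs_sub (score f k γ y θ) (score f k γ y (θstar γ))).trans
          (add_le_add h3 h4)
        have h7 := Real.sq_sqrt (henv.nonneg y)
        have h8 := mul_le_mul_of_nonneg_left h6 (Real.sqrt_nonneg (h y))
        nlinarith
    _ = 12 * d * h y := by simp; ring

/-- The score is close to its value at the target if the posterior expectation of the discrepancy
is small. -/
lemma Regular.abs_hScore_sub_le (hreg : Regular f Θ prior g Γ)
    (hid : Identified f Θ prior g Γ θstar) (henv : IsEnvelope f Θ Γ h) (hγ : γ ∈ Γ)
    (y : Fin n → E d) :
    |hScore f Θ prior γ y - ∑ i, targetScore f θstar γ (y i)|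
      ≤ ∫ θ, ∑ i, scoreDist f h θstar γ (y i) θ ∂postMeasure f Θ prior γ y := by
  have := hreg.isProbabilityMeasure_post hγ y
  have hs := hid.mem γ hγ
  have hc₂ : ∀ i k, ContinuousOn (fun θ => score₂ f k γ (y i) θ + score f k γ (y i) θ ^ 2) Θ :=
    fun i k => (hreg.continuousOn_score₂_param hγ (y i) k).add
      ((hreg.continuousOn_score_param hγ (y i) k).pow 2)
  have hi₂ : ∀ i k, Integrable (fun θ => score₂ f k γ (y i) θ + score f k γ (y i) θ ^ 2)
      (postMeasure f Θ prior γ y) := fun i k =>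
    hreg.integrable_param postMeasure_absolutelyContinuous (hc₂ i k)
      fun θ hθ => henv.abs_score₂_add_le hγ hθ (y i) k
  have hi₁ : ∀ i k, Integrable (fun θ => score f k γ (y i) θ) (postMeasure f Θ prior γ y) :=
    fun i k => hreg.integrable_score_post hγ y (y i) k
  have ha₂ : ∀ i k, Integrable (fun θ => 2 * |(score₂ f k γ (y i) θ + score f k γ (y i) θ ^ 2)
      - (score₂ f k γ (y i) (θstar γ) + score f k γ (y i) (θstar γ) ^ 2)|)
      (postMeasure f Θ prior γ y) := fun i k =>
    (((hi₂ i k).sub (integrable_const _)).abs).const_mul 2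
  have ha₁ : ∀ i k, Integrable (fun θ => 2 * √(h (y i)) * |score f k γ (y i) θ
      - score f k γ (y i) (θstar γ)|) (postMeasure f Θ prior γ y) := fun i k =>
    (((hi₁ i k).sub (integrable_const _)).abs).const_mul _
  simp only [scoreDist]
  rw [hreg.hScore_eq, ← Finset.sum_sub_distrib, integral_finsetSum]
  swap
  · exact fun i _ => integrable_finsetSum _ fun k _ => (ha₂ i k).add (ha₁ i k)
  refine (Finset.abs_sum_le_sum_abs _ _).trans (Finset.sum_le_sum fun i _ => ?_)
  rw [targetScore, ← Finset.sum_sub_distrib, integral_finsetSum]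
  swap
  · exact fun k _ => (ha₂ i k).add (ha₁ i k)
  refine (Finset.abs_sum_le_sum_abs _ _).trans (Finset.sum_le_sum fun k _ => ?_)
  rw [integral_add (ha₂ i k) (ha₁ i k), integral_const_mul, integral_const_mul]
  have h1 := hreg.abs_integral_post_sub_le hγ y (hi₂ i k)
    (score₂ f k γ (y i) (θstar γ) + score f k γ (y i) (θstar γ) ^ 2)
  have h2 := hreg.abs_integral_post_sub_le hγ y (hi₁ i k) (score f k γ (y i) (θstar γ))
  have h3 := hreg.abs_integral_post_le hγ y fun θ hθ => henv.abs_score_le_sqrt hγ hθ (y i) k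
  have h4 := henv.abs_score_le_sqrt hγ hs (y i) k
  generalize ∫ θ, score f k γ (y i) θ ∂postMeasure f Θ prior γ y = a at *
  generalize score f k γ (y i) (θstar γ) = b at *
  generalize ∫ θ, (score₂ f k γ (y i) θ + score f k γ (y i) θ ^ 2)
    ∂postMeasure f Θ prior γ y = A at *
  generalize score₂ f k γ (y i) (θstar γ) + b ^ 2 = B at *
  -- Both `a` and `b` are at most √h in absolute value, whence the factor 2√h in `scoreDist`.
  rw [show 2 * A - a ^ 2 - (2 * B - b ^ 2) = 2 * (A - B) + -((a + b) * (a - b)) by ring]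
  refine (abs_add_le _ _).trans (add_le_add ?_ ?_)
  · rw [abs_mul, abs_two]
    linarith
  · rw [abs_neg, abs_mul]
    refine mul_le_mul ((abs_add_le _ _).trans (by linarith)) h2 (abs_nonneg _) (by positivity)

variable {Ω : Type*} [MeasurableSpace Ω] {P : Measure Ω} {Y : ℕ → Ω → E d}

/-- The posterior expectation of the average discrepancy vanishes, uniformly in the tuning
parameter. -/
lemma Identified.ae_tendsto_scoreDist (hreg : Regular f Θ prior g Γ)
    (hid : Identified f Θ prior g Γ θstar) (henv : IsEnvelope f Θ Γ h)
    (hi : Integrable (fun y => h y * g y)) (hlaw : ∀ i, HasLaw (Y i) (dataLaw g) P)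
    (hindep : iIndepFun Y P) :
    ∀ᵐ ω ∂P, Tendsto (fun q : ℕ × ℝ =>
      ∫ θ, (q.1 : ℝ)⁻¹ * ∑ i : Fin q.1, scoreDist f h θstar q.2 (Y i ω) θ
        ∂postMeasure f Θ prior q.2 (fun i : Fin q.1 => Y i ω)) (atTop ×ˢ 𝓟 Γ) (𝓝 0) := by
  obtain ⟨K, u, ht⟩ := hid.exists_tailBound hreg
  have hcont := (hid.continuousOn_scoreDist hreg henv).mono
    (prod_mono_left (prod_mono_right ht.subset : Γ ×ˢ K ⊆ Γ ×ˢ Θ))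
  have hH : Integrable (fun y => 12 * d * h y) (dataLaw g) :=
    (hreg.integrable_data_iff.2 hi).const_mul _
  have hb : ∀ q ∈ Γ ×ˢ K, ∀ y, |scoreDist f h θstar q.1 y q.2| ≤ 12 * d * h y :=
    fun q hq y => by
      rw [abs_of_nonneg (scoreDist_nonneg y)]
      exact henv.scoreDist_le hid hq.1 (ht.subset hq.2) y
  have hunif := tendstoUniformlyOn_average hlaw hindep
    (hreg.isCompact_tuning.prod ht.isCompact) (φ := fun q y => scoreDist f h θstar q.1 y q.2)
    hcont hH hb
  have hmean := continuousOn_integral_of_continuousOn (T := ℝ × E p)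
    (φ := fun q y => scoreDist f h θstar q.1 y q.2) hcont hH hb
  filter_upwards [hid.ae_concentrates hreg hlaw hindep, hunif,
    tendsto_average hlaw hindep hH] with ω hconc hω hHω
  refine hconc.tendsto_integral hreg
    (b := fun n γ θ => (n : ℝ)⁻¹ * ∑ i : Fin n, scoreDist f h θstar γ (Y i ω) θ)
    (C := ∫ y, 12 * d * h y ∂dataLaw g + 1)
    (fun n γ _ θ _ => mul_nonneg (by positivity)
      (Finset.sum_nonneg fun i _ => scoreDist_nonneg _)) ?_ fun ε hε => ?_
  -- On all of `Θ`, including outside `K`, a crude bound suffices: the average of the envelope is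
  -- eventually below its mean plus one.
  · filter_upwards [hHω.eventually_le_const (lt_add_one _)] with n hn γ hγ θ hθ
    refine le_trans ?_ hn
    gcongr with i
    exact henv.scoreDist_le hid hγ hθ _
  -- The mean discrepancy is continuous and zero at the target, hence small near it; the uniform law
  -- on Γ × K carries this over to the empirical average.
  · obtain ⟨δ, hδ, hnear⟩ := ht.exists_near hreg hid hmean
      (fun γ hγ => by simp [scoreDist_star]) (half_pos hε)
    refine ⟨δ, hδ, ?_⟩
    filter_upwards [Metric.tendstoUniformlyOn_iff.1 hω (ε / 2) (half_pos hε)]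
      with n hn γ hγ θ hθ hd
    obtain ⟨hK, hle⟩ := hnear γ hγ θ hθ hd
    have h1 := hn (γ, θ) ⟨hγ, hK⟩
    rw [Real.dist_eq] at h1
    have h2 := (abs_lt.1 h1).1
    linarith

lemma Identified.continuousOn_targetScore (hreg : Regular f Θ prior g Γ)
    (hid : Identified f Θ prior g Γ θstar) :
    ContinuousOn (fun q : ℝ × E d => targetScore f θstar q.1 q.2) (Γ ×ˢ univ) :=
  continuousOn_finsetSum _ fun k _ =>
    (continuousOn_const.mul (hid.continuousOn_comp_star hreg
      (φ := fun γ y θ => score₂ f k γ y θ + score f k γ y θ ^ 2)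
      (hreg.continuousOn_score₂_add k))).sub
    ((hid.continuousOn_comp_star hreg (hreg.continuousOn_score k)).pow 2)

lemma IsEnvelope.abs_targetScore_le (henv : IsEnvelope f Θ Γ h)
    (hid : Identified f Θ prior g Γ θstar) (hγ : γ ∈ Γ) (y : E d) :
    |targetScore f θstar γ y| ≤ 5 * d * h y := by
  have hs := hid.mem γ hγ
  calc |targetScore f θstar γ y| ≤ ∑ _k : Fin d, 5 * h y := by
        refine (Finset.abs_sum_le_sum_abs _ _).trans (Finset.sum_le_sum fun k _ => ?_)
        have h1 := abs_le.1 (henv.abs_score₂_add_le hγ hs y k)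
        have h2 := henv.score_sq_le γ hγ _ hs y k
        have h3 := sq_nonneg (score f k γ y (θstar γ))
        exact abs_le.2 ⟨by linarith, by linarith⟩
    _ = 5 * d * h y := by simp; ring

/-- The score per observation converges almost surely, uniformly in the tuning parameter, to the
expected Hyvärinen score at the target. -/
theorem Identified.ae_tendsto_hScore (hreg : Regular f Θ prior g Γ)
    (hid : Identified f Θ prior g Γ θstar) (hlaw : ∀ i, HasLaw (Y i) (dataLaw g) P)
    (hindep : iIndepFun Y P) :
    ∀ᵐ ω ∂P, Tendsto (fun q : ℕ × ℝ =>
      (q.1 : ℝ)⁻¹ * hScore f Θ prior q.2 (fun i : Fin q.1 => Y i ω)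
        - ∫ y, targetScore f θstar q.2 y ∂dataLaw g) (atTop ×ˢ 𝓟 Γ) (𝓝 0) := by
  obtain ⟨h, henv, hi⟩ := hreg.exists_isEnvelope
  have hunif := tendstoUniformlyOn_average hlaw hindep hreg.isCompact_tuning
    (φ := targetScore f θstar) (hid.continuousOn_targetScore hreg)
    ((hreg.integrable_data_iff.2 hi).const_mul (5 * d : ℝ))
    fun γ hγ y => henv.abs_targetScore_le hid hγ y
  filter_upwards [hid.ae_tendsto_scoreDist hreg henv hi hlaw hindep, hunif] with ω h1 h2
  have h3 : Tendsto (fun q : ℕ × ℝ =>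
      (q.1 : ℝ)⁻¹ * ∑ i : Fin q.1, targetScore f θstar q.2 (Y i ω)
        - ∫ y, targetScore f θstar q.2 y ∂dataLaw g) (atTop ×ˢ 𝓟 Γ) (𝓝 0) := by
    rw [Metric.tendsto_nhds]
    intro ε hε
    rw [eventually_prod_principal_iff]
    filter_upwards [Metric.tendstoUniformlyOn_iff.1 h2 ε hε] with n hn γ hγ
    have := hn γ hγ
    rw [dist_comm, Real.dist_eq] at this
    rwa [dist_zero_right]
  have h4 : Tendsto (fun q : ℕ × ℝ => (q.1 : ℝ)⁻¹ *
      (hScore f Θ prior q.2 (fun i : Fin q.1 => Y i ω)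
        - ∑ i : Fin q.1, targetScore f θstar q.2 (Y i ω))) (atTop ×ˢ 𝓟 Γ) (𝓝 0) := by
    refine squeeze_zero_norm' ?_ h1
    rw [eventually_prod_principal_iff]
    refine Eventually.of_forall fun n γ hγ => ?_
    rw [Real.norm_eq_abs, abs_mul, integral_const_mul, abs_of_nonneg (by positivity)]
    gcongr
    exact hreg.abs_hScore_sub_le hid henv hγ fun i : Fin n => Y i ω
  have h5 := h4.add h3
  rw [add_zero] at h5
  exact h5.congr fun q => by ring

/-- Almost sure consistency of the minimisers of the leave-one-out score. -/
theorem Identified.ae_tendsto_minimiser (hreg : Regular f Θ prior g Γ)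
    (hid : Identified f Θ prior g Γ θstar) (hlaw : ∀ i, HasLaw (Y i) (dataLaw g) P)
    (hindep : iIndepFun Y P) {γstar : ℝ} (hγstar : γstar ∈ Γ)
    (hmin : ∀ γ ∈ Γ, γ ≠ γstar →
      fisherDivergence g (fun y => exp (logLik f γstar y (θstar γstar)))
        < fisherDivergence g (fun y => exp (logLik f γ y (θstar γ)))) :
    ∀ᵐ ω ∂P, ∀ γhat : ℕ → ℝ,
      (∀ᶠ n : ℕ in atTop, γhat n ∈ Γ ∧
        IsMinOn (fun γ => looScore f Θ prior γ (fun i : Fin n => Y i ω)) Γ (γhat n)) →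
      Tendsto γhat atTop (𝓝 γstar) := by
  obtain ⟨h, henv, hi⟩ := hreg.exists_isEnvelope
  filter_upwards [hid.ae_tendsto_hScore hreg hlaw hindep] with ω hω γhat hhat
  refine tendsto_of_isMinOn hreg.isCompact_tuning
    (F := fun n γ => (n : ℝ)⁻¹ * hScore f Θ prior γ (fun i : Fin n => Y i ω))
    (continuousOn_integral_of_continuousOn (hid.continuousOn_targetScore hreg)
      ((hreg.integrable_data_iff.2 hi).const_mul (5 * d : ℝ))
      fun γ hγ y => henv.abs_targetScore_le hid hγ y) hω hγstar (fun γ hγ hne => ?_)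
    (hhat.mono fun n hn => ⟨hn.1, fun γ hγ => ?_⟩)
  -- The Fisher information of `g` is common to both divergences and cancels, leaving the expected
  -- target scores.
  · have h1 := hmin γ hγ hne
    rw [hreg.fisherDivergence_eq, hreg.fisherDivergence_eq, hreg.integral_targetGap hid hγ,
      hreg.integral_targetGap hid hγstar] at h1
    exact lt_of_add_lt_add_left h1
  · have h1 : looScore f Θ prior (γhat n) (fun i : Fin n => Y i ω)
        ≤ looScore f Θ prior γ (fun i : Fin n => Y i ω) := hn.2 hγ
    rw [hreg.looScore_eq_hScore hn.1, hreg.looScore_eq_hScore hγ] at h1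
    exact mul_le_mul_of_nonneg_left h1 (by positivity)

end ScoreConvergence

end RobustBayes

end

theorem proposition2 {p d : ℕ} (f : E p → E d → ℝ) (Θ : Set (E p)) (prior : E p → ℝ)
    (g : E d → ℝ) (Γ : Set ℝ) (θstar : ℝ → E p)
    (hreg : Regular f Θ prior g Γ) (hid : Identified f Θ prior g Γ θstar)
    -- i.i.d. data with density `g`
    {Ω : Type*} [MeasurableSpace Ω] (P : Measure Ω) [IsProbabilityMeasure P]
    (Y : ℕ → Ω → E d)
    (hlaw : ∀ i, HasLaw (Y i) ((volume : Measure (E d)).withDensity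
      (fun y => ENNReal.ofReal (g y))) P)
    (hindep : iIndepFun Y P) :
    -- the limit that defines the Fisher divergence per observation exists, uniformly on `Γ`,
    -- and is the Fisher divergence at the target `θstar γ`
    TendstoUniformlyOn (fun (n : ℕ) (γ : ℝ) => marginalFisher f Θ prior g n γ / n)
        (fisherRate f Θ prior g) atTop Γ ∧
    (∀ γ ∈ Γ, fisherRate f Θ prior g γ
        = fisherDivergence g (fun y => Real.exp (logLik f γ y (θstar γ)))) ∧
    -- the two forms of the score agree, and it has a minimiser on `Γ`
    (∀ (n : ℕ) (y : Fin n → E d), ∀ γ ∈ Γ, looScore f Θ prior γ y = hScore f Θ prior γ y) ∧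
    (Γ.Nonempty → ∀ (n : ℕ) (y : Fin n → E d),
      ∃ γ ∈ Γ, IsMinOn (fun γ => looScore f Θ prior γ y) Γ γ) ∧
    -- if `γstar` is the unique minimiser of the Fisher divergence on `Γ`, then almost surely
    -- every sequence of minimisers of the score converges to `γstar`
    (∀ γstar ∈ Γ,
      (∀ γ ∈ Γ, γ ≠ γstar → fisherRate f Θ prior g γstar < fisherRate f Θ prior g γ) →
      ∀ᵐ ω ∂P, ∀ γhat : ℕ → ℝ,
        (∀ᶠ n : ℕ in atTop, γhat n ∈ Γ ∧
          IsMinOn (fun γ => looScore f Θ prior γ (fun i : Fin n => Y i ω)) Γ (γhat n)) →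
        Tendsto γhat atTop (𝓝 γstar)) := by
  change ∀ i, HasLaw (Y i) (dataLaw g) P at hlaw
  refine ⟨hid.tendstoUniformlyOn_marginalFisher hreg hlaw hindep,
    fun γ hγ => hid.fisherRate_eq hreg hlaw hindep hγ,
    fun n y γ hγ => hreg.looScore_eq_hScore hγ y, fun hne n y => ?_, fun γstar hγstar hmin => ?_⟩
  -- Continuity in γ is available for the posterior form of the score; the minimiser is then
  -- transferred by equality of the two forms on `Γ`.
  · obtain ⟨γ, hγ, hmin⟩ := hreg.isCompact_tuning.exists_isMinOn hne (hreg.continuousOn_hScore y)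
    refine ⟨γ, hγ, fun γ' hγ' => ?_⟩
    have h1 : hScore f Θ prior γ y ≤ hScore f Θ prior γ' y := hmin hγ'
    rwa [← hreg.looScore_eq_hScore hγ, ← hreg.looScore_eq_hScore hγ'] at h1
  · refine hid.ae_tendsto_minimiser hreg hlaw hindep hγstar fun γ hγ hne => ?_
    rw [← hid.fisherRate_eq hreg hlaw hindep hγ, ← hid.fisherRate_eq hreg hlaw hindep hγstar]
    exact hmin γ hγ hne
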